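/- Fix the following setting. Let $0<\alpha<1$, and let $0=t_0<t_1<t_2<\cdots$ be an arbitrary grid with finitely many points $t_0,\dots,t_N$ or with infinitely many points ($N=\infty$); put $\tau_n=t_n-t_{n-1}$. Below, $n$ ranges over the grid indices $n\le N$. For a lower triangular array of real numbers $C=(c_{n-j}^n)_{1\le j\le n}$ put $$\mathcal D_\tau^\alpha u_n=\sum_{j=1}^n c_{n-j}^n\,(u_j-u_{j-1}),\qquad n\ge1 .$$ Arrays are multiplied as lower triangular matrices, $(A\,\bar*\,B)_{n-k}^n=\sum_{j=k}^n a_{n-j}^n b_{j-k}^j$. The scheme is called completely positive if there is an invertible array $A$ such that all (lower triangular) entries of $A\,\bar*\,C$ are equal to $1$ and the inverse $B=(b_{n-j}^n)$ of $A$ satisfies, for all $n\ge1$, $b_0^n>0$, $b_{n-j}^n\le0$ for $1\le j<n$, and $\sum_{j=1}^n b_{n-j}^n\ge0$. Let $g_{1-\alpha}(s)=s^{-\alpha}/\Gamma(1-\alpha)$ for $s>0$ and $E_\alpha(z)=\sum_{k\ge0}z^k/\Gamma(\alpha k+1)$. **Theorem.** There is a universal constant $\sigma>1$ (independent of $\alpha$,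 the grid, the scheme, $\lambda$, $c$, $\nu$, $\rho_1$ and the sequence) such that the following holds. Let the scheme be completely positive, let $\lambda>0$ and $c\in\mathbb R$, and let $(v_n)$ be a nonnegative sequence with $v_0>c/\lambda$. (1) Suppose that for some $\nu>0$ one has $c_{n-j}^n\ge\nu\,\frac1{\tau_j}\int_{t_{j-1}}^{t_j}g_{1-\alpha}(t_n-s)\,ds$ for all $1\le j\le n$. If $\mathcal D_\tau^\alpha v_n\ge-\lambda v_n+c$ for all $n\ge1$, then for all $n\ge0$ $$v_n\ge\Big(v_0-\frac c\lambda\Big)E_\alpha\big(-\nu^{-1}\lambda t_n^\alpha\big)+\frac c\lambda .$$ (2) Suppose that for some $\rho_1>0$ one has $c_{n-j}^n\le\rho_1\,\frac1{\tau_j}\int_{t_{j-1}}^{t_j}g_{1-\alpha}(t_n-s)\,ds$ for all $1\le j\le n$. If $\mathcal D_\tau^\alpha v_n\le-\lambda v_n+c$ for all $n\ge1$, then for all $n\ge0$ $$v_n\le\Big(v_0-\frac c\lambda\Big)E_\alpha\Big(-\frac{\lambda(1-\alpha)}{\rho_1}t_n^\alpha\Big)+\frac c\lambda .$$ If moreover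 $\lambda\tau_n^\alpha\le1$ for all $n\ge1$ and $\sigma\rho_1\ge1$ (in particular whenever $\rho_1\ge1$), then for all $n\ge0$ $$v_n\le\Big(v_0-\frac c\lambda\Big)E_\alpha\Big(-\frac{\lambda}{\sigma\rho_1}t_n^\alpha\Big)+\frac c\lambda .$$ -/

import Mathlib

open scoped BigOperators

noncomputable section

namespace FracGronwall

/-- The Abel kernel `g_β(s) = s^(β-1) / Γ(β)` for `s > 0`, extended by zero to `s ≤ 0`. -/
def abelKernel (β s : ℝ) : ℝ :=
  if 0 < s then s ^ (β - 1) / Real.Gamma β else 0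

/-- The two-parameter Mittag-Leffler function `E_{α,β}` at a real argument, by its power series
(which converges for every argument when `α > 0`). -/
def mittagLeffler₂ (α β z : ℝ) : ℝ :=
  ∑' k : ℕ, z ^ k / Real.Gamma (α * k + β)

/-- The Mittag-Leffler function `E_α = E_{α,1}`. -/
def mittagLeffler (α z : ℝ) : ℝ := mittagLeffler₂ α 1 z

/-- A grid `0 = t_0 < t_1 < ⋯` with points `t_n`, `n ≤ N`. The number `N` of steps is finite, or
`⊤` for infinitely many grid points; values of `t` beyond `N` are irrelevant. -/
structure IsGrid (N : ℕ∞) (t : ℕ → ℝ) : Prop where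
  zero : t 0 = 0
  lt : ∀ n : ℕ, 1 ≤ n → (n : ℕ∞) ≤ N → t (n - 1) < t n

/-- The step size `τ_n = t_n - t_{n-1}`, for `n ≥ 1`. -/
def step (t : ℕ → ℝ) (n : ℕ) : ℝ := t n - t (n - 1)

/-- A lower triangular array kernel: `K n k` is the entry `K_k^n`. Only the entries with
`n ≥ 1` and `0 ≤ k ≤ n - 1` are meaningful. -/
abbrev ArrayKernel : Type := ℕ → ℕ → ℝ

/-- Two array kernels have the same rows `1, …, N`. -/
def EqUpTo (N : ℕ∞) (K K' : ArrayKernel) : Prop :=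
  ∀ n k : ℕ, k < n → (n : ℕ∞) ≤ N → K n k = K' n k

/-- The pseudo-convolution `(A ∗ B)_k^n = ∑_{j=0}^k A_{k-j}^n B_j^{n+j-k}`, that is, the product
of lower triangular arrays. -/
def pconv (A B : ArrayKernel) : ArrayKernel :=
  fun n k => ∑ j ∈ Finset.range (k + 1), A n (k - j) * B (n + j - k) j

/-- The identity kernel `I_{n-j}^n = δ_{nj}`. -/
def idKernel : ArrayKernel := fun _ k => if k = 0 then 1 else 0

/-- The kernel `L` all of whose (lower triangular) entries are one. -/
def onesKernel : ArrayKernel := fun _ _ => 1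

/-- `B` is the inverse of `A` for the pseudo-convolution. -/
def IsInverse (N : ℕ∞) (A B : ArrayKernel) : Prop :=
  EqUpTo N (pconv A B) idKernel ∧ EqUpTo N (pconv B A) idKernel

/-- The array kernel `A` is completely positive: it is invertible, and its inverse `B` has positive
diagonal entries, nonpositive off-diagonal entries and nonnegative row sums. -/
def CompletelyPositive (N : ℕ∞) (A : ArrayKernel) : Prop :=
  ∃ B : ArrayKernel, IsInverse N A B ∧
    ∀ n : ℕ, 1 ≤ n → (n : ℕ∞) ≤ N →
      0 < B n 0 ∧
      (∀ j : ℕ, 1 ≤ j → j < n → B n (n - j) ≤ 0) ∧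
      0 ≤ ∑ j ∈ Finset.Icc 1 n, B n (n - j)

/-- `C` is the right complementary kernel of `A`, that is, `A ∗ C = L`. -/
def IsRightComplementary (N : ℕ∞) (A C : ArrayKernel) : Prop :=
  EqUpTo N (pconv A C) onesKernel

/-- The discretization of the fractional derivative with kernel `C` is completely positive: the
kernel `A` of the equivalent integral scheme, whose right complementary kernel is `C`, is
completely positive. -/
def CompletelyPositiveScheme (N : ℕ∞) (C : ArrayKernel) : Prop :=
  ∃ A : ArrayKernel, IsRightComplementary N A C ∧ CompletelyPositive N A

/-- The discrete fractional derivative `D_τ^α u_n = ∑_{j=1}^n C_{n-j}^n (u_j - u_{j-1})`. -/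
def discreteDeriv (C : ArrayKernel) (u : ℕ → ℝ) (n : ℕ) : ℝ :=
  ∑ j ∈ Finset.Icc 1 n, C n (n - j) * (u j - u (j - 1))

/-- The average of `s ↦ g_{1-α}(t_n - s)` over `[t_{j-1}, t_j]`. -/
def kernelAverage (α : ℝ) (t : ℕ → ℝ) (n j : ℕ) : ℝ :=
  1 / step t j * ∫ s in (t (j - 1))..(t j), abelKernel (1 - α) (t n - s)

/-- The lower kernel bound with constant `ν`. -/
def KernelLowerBound (α : ℝ) (N : ℕ∞) (t : ℕ → ℝ) (C : ArrayKernel) (ν : ℝ) : Prop :=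
  ∀ n j : ℕ, 1 ≤ j → j ≤ n → (n : ℕ∞) ≤ N → ν * kernelAverage α t n j ≤ C n (n - j)

/-- The upper kernel bound with constant `ρ₁`. -/
def KernelUpperBound (α : ℝ) (N : ℕ∞) (t : ℕ → ℝ) (C : ArrayKernel) (ρ₁ : ℝ) : Prop :=
  ∀ n j : ℕ, 1 ≤ j → j ≤ n → (n : ℕ∞) ≤ N → C n (n - j) ≤ ρ₁ * kernelAverage α t n j

end FracGronwall

end

/-!
Complete positivity makes the rows of the scheme nonnegative and nonincreasing in the lag, so
summation by parts gives a comparison principle: a subsolution lies below a supersolution. It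
remains to decide for which `μ` the samples of `E_α(-μ t^α)` are a sub- or a supersolution of the
discrete relaxation equation.

With `r(s) = s^(α-1) E_{α,α}(-μ s^α)`, the increments of `E_α(-μ t^α)` are `-μ ∫ r`, and
`∫₀ᵀ r(s) g_{1-α}(T - s) ds = E_α(-μ T^α)`. On each step one therefore compares
`average(g) * ∫ r` with `∫ g r`, where `g(s) = g_{1-α}(t_n - s)`. As `r` decreases and `g`
increases, Chebyshev's inequality gives `∫ g r ≤ average(g) * ∫ r`, which is the lower bound.
Conversely `average(g) ≤ g(t_{j-1}) / (1 - α)` gives `average(g) * ∫ r ≤ ∫ g r / (1 - α)`. On small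
steps the factor `1 / (1 - α)` can be made universal: it is at most `2` for `α ≤ 1/2`, while for
`α ≥ 1/2` the function `E_{α,α}(-μ s^α)` decreases by at most a universal factor over a step with
`μ τ^α ≤ 1`.

By the resolvent identity for Mittag-Leffler kernels, `z ↦ E_{α,α}(-z)` decreases up to its first
zero. A decay estimate rules out such a zero, so `r` is positive and decreasing; the same estimate
bounds the loss over a short step.
-/

/-! ### The comparison principle -/

namespace FracGronwall

open Finset

section Comparison

variable {N : ℕ∞} {A B C : ArrayKernel}

theorem pconv_assoc (A B C : ArrayKernel) {n k : ℕ} (hk : k < n) :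
    pconv (pconv A B) C n k = pconv A (pconv B C) n k := by
  simp only [pconv, sum_mul, mul_sum]
  rw [sum_sigma', sum_sigma']
  refine sum_bij' (fun p _ => ⟨p.1 + p.2, p.1⟩) (fun p _ => ⟨p.2, p.1 - p.2⟩)
    (fun p hp => ?_) (fun p hp => ?_) (fun p hp => ?_) (fun p hp => ?_) (fun p hp => ?_) <;>
    simp only [mem_sigma, mem_range] at hp ⊢
  · omega
  · omega
  · simp
  · simp [show p.2 + (p.1 - p.2) = p.1 by omega]
  · rw [show k - p.1 - p.2 = k - (p.1 + p.2) by omega,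
      show n + p.2 - (k - p.1) = n + (p.1 + p.2) - k by omega,
      show p.1 + p.2 - p.1 = p.2 by omega,
      show n + (p.1 + p.2) - k + p.1 - (p.1 + p.2) = n + p.1 - k by omega, mul_assoc]

theorem EqUpTo.pconv_left (h : EqUpTo N A B) : EqUpTo N (pconv A C) (pconv B C) :=
  fun n k hk hn => sum_congr rfl fun j _ => by rw [h n (k - j) (by omega) hn]

theorem EqUpTo.pconv_right (h : EqUpTo N B C) : EqUpTo N (pconv A B) (pconv A C) := by
  refine fun n k hk hn => sum_congr rfl fun j hj => ?_
  have hjk : j ≤ k := mem_range_succ_iff.1 hj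
  rw [h (n + j - k) j (by omega) (hn.trans' (by gcongr; omega))]

theorem idKernel_pconv (C : ArrayKernel) : pconv idKernel C = C := by
  ext n k
  rw [pconv, sum_eq_single_of_mem k (self_mem_range_succ k)]
  · simp [idKernel]
  · intro j hj hjk
    have hlt : j < k := lt_of_le_of_ne (mem_range_succ_iff.1 hj) hjk
    simp [idKernel, Nat.sub_ne_zero_of_lt hlt]

theorem pconv_onesKernel (B : ArrayKernel) (n k : ℕ) :
    pconv B onesKernel n k = ∑ i ∈ range (k + 1), B n i := by
  simp only [pconv, onesKernel, mul_one]
  exact sum_flip (B n)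

theorem IsRightComplementary.eq_sum_of_isInverse (hAC : IsRightComplementary N A C)
    (hAB : IsInverse N A B) {n k : ℕ} (hk : k < n) (hn : (n : ℕ∞) ≤ N) :
    C n k = ∑ i ∈ range (k + 1), B n i := by
  calc C n k = pconv idKernel C n k := by rw [idKernel_pconv]
    _ = pconv (pconv B A) C n k := (hAB.2.pconv_left n k hk hn).symm
    _ = pconv B (pconv A C) n k := pconv_assoc B A C hk
    _ = pconv B onesKernel n k := EqUpTo.pconv_right hAC n k hk hn
    _ = ∑ i ∈ range (k + 1), B n i := pconv_onesKernel B n k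

/-- The rows of `C` are nonnegative and nonincreasing in the lag `k`, with positive diagonal
entries. This is the form in which complete positivity enters the comparison principle. -/
structure IsMonotoneKernel (N : ℕ∞) (C : ArrayKernel) : Prop where
  diag_pos : ∀ n : ℕ, 1 ≤ n → (n : ℕ∞) ≤ N → 0 < C n 0
  succ_le : ∀ n k : ℕ, k + 1 < n → (n : ℕ∞) ≤ N → C n (k + 1) ≤ C n k
  nonneg : ∀ n k : ℕ, k < n → (n : ℕ∞) ≤ N → 0 ≤ C n k

theorem CompletelyPositiveScheme.isMonotoneKernel (h : CompletelyPositiveScheme N C) :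
    IsMonotoneKernel N C := by
  obtain ⟨A, hAC, B, hAB, hB⟩ := h
  have hC {n k : ℕ} := hAC.eq_sum_of_isInverse hAB (n := n) (k := k)
  have hoff {n k : ℕ} (hk : 1 ≤ k) (hkn : k < n) (hn : (n : ℕ∞) ≤ N) : B n k ≤ 0 := by
    simpa [Nat.sub_sub_self hkn.le] using (hB n (by omega) hn).2.1 (n - k) (by omega) (by omega)
  refine ⟨fun n hn hN => ?_, fun n k hk hn => ?_, fun n k hk hn => ?_⟩
  · simpa [hC hn hN] using (hB n hn hN).1
  · rw [hC hk hn, hC (by omega) hn, sum_range_succ _ (k + 1)]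
    exact add_le_of_nonpos_right (hoff (by omega) hk hn)
  · have hrow : 0 ≤ ∑ i ∈ range n, B n i := by
      refine (hB n (by omega) hn).2.2.trans_eq ?_
      refine sum_nbij' (n - ·) (n - ·) ?_ ?_ ?_ ?_ (fun _ _ => rfl) <;>
        simp only [mem_Icc, mem_range] <;> omega
    have htail : ∑ i ∈ Ico (k + 1) n, B n i ≤ 0 := sum_nonpos fun i hi => by
      obtain ⟨h1, h2⟩ := mem_Ico.1 hi
      exact hoff (by omega) h2 hn
    rw [← sum_range_add_sum_Ico _ (show k + 1 ≤ n from hk)] at hrow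
    rw [hC hk hn]
    linarith

theorem sum_mul_sub_le {a w : ℕ → ℝ} {m : ℕ} (hm : 1 ≤ m) (ha₁ : 0 ≤ a 1)
    (ha : ∀ j, 1 ≤ j → j < m → a j ≤ a (j + 1)) (hw : ∀ j < m, 0 ≤ w j) :
    ∑ j ∈ Icc 1 m, a j * (w j - w (j - 1)) ≤ a m * w m := by
  induction m, hm using Nat.le_induction with
  | base => simpa [mul_sub] using mul_nonneg ha₁ (hw 0 one_pos)
  | succ m hm ih =>
    rw [sum_Icc_succ_top (by omega), Nat.add_sub_cancel]
    have hinit := ih (fun j h h' => ha j h (by omega)) (fun j h => hw j (by omega))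
    have hlast := mul_le_mul_of_nonneg_right (ha m hm (by omega)) (hw m (by omega))
    linarith

theorem IsMonotoneKernel.nonneg_of_le_discreteDeriv (hC : IsMonotoneKernel N C) {lam : ℝ}
    (hlam : 0 ≤ lam) {w : ℕ → ℝ} (h0 : 0 ≤ w 0)
    (hw : ∀ n : ℕ, 1 ≤ n → (n : ℕ∞) ≤ N → -lam * w n ≤ discreteDeriv C w n) (n : ℕ)
    (hn : (n : ℕ∞) ≤ N) : 0 ≤ w n := by
  induction n using Nat.strong_induction_on with
  | _ n ih =>
    rcases Nat.eq_zero_or_pos n with rfl | hpos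
    · exact h0
    by_contra! hneg
    have habel : discreteDeriv C w n ≤ C n (n - n) * w n := by
      refine sum_mul_sub_le (a := fun j => C n (n - j)) hpos
        (hC.nonneg n _ (by omega) hn) (fun j hj hjn => ?_) fun j hj =>
          ih j hj (hn.trans' (by gcongr))
      simpa [show n - (j + 1) + 1 = n - j by omega] using hC.succ_le n (n - (j + 1)) (by omega) hn
    rw [Nat.sub_self] at habel
    have hdiag := mul_neg_of_pos_of_neg (hC.diag_pos n hpos hn) hneg
    have hrelax := mul_nonneg_of_nonpos_of_nonpos (neg_nonpos.2 hlam) hneg.le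
    linarith [hw n hpos hn]

theorem discreteDeriv_sub (C : ArrayKernel) (u w : ℕ → ℝ) (n : ℕ) :
    discreteDeriv C (fun k => w k - u k) n = discreteDeriv C w n - discreteDeriv C u n := by
  simp only [discreteDeriv, ← sum_sub_distrib]
  exact sum_congr rfl fun j _ => by ring

theorem discreteDeriv_mul_add (C : ArrayKernel) (u : ℕ → ℝ) (d e : ℝ) (n : ℕ) :
    discreteDeriv C (fun k => d * u k + e) n = d * discreteDeriv C u n := by
  simp only [discreteDeriv, mul_sum]
  exact sum_congr rfl fun j _ => by ring

theorem IsMonotoneKernel.le_of_discreteDeriv_le (hC : IsMonotoneKernel N C) {lam c : ℝ}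
    (hlam : 0 ≤ lam) {u w : ℕ → ℝ} (h0 : u 0 ≤ w 0)
    (hu : ∀ n : ℕ, 1 ≤ n → (n : ℕ∞) ≤ N → discreteDeriv C u n ≤ -lam * u n + c)
    (hw : ∀ n : ℕ, 1 ≤ n → (n : ℕ∞) ≤ N → -lam * w n + c ≤ discreteDeriv C w n) (n : ℕ)
    (hn : (n : ℕ∞) ≤ N) : u n ≤ w n := by
  refine sub_nonneg.1 (hC.nonneg_of_le_discreteDeriv hlam (w := fun k => w k - u k)
    (sub_nonneg.2 h0) (fun m hm hmN => ?_) n hn)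
  rw [discreteDeriv_sub]
  linarith [hu m hm hmN, hw m hm hmN]

variable {lam c : ℝ} {v φ : ℕ → ℝ}

theorem IsMonotoneKernel.le_mul_add_of_supersolution (hC : IsMonotoneKernel N C) (hlam : 0 < lam)
    (h0 : c / lam ≤ v 0) (hφ0 : φ 0 = 1)
    (hφ : ∀ n : ℕ, 1 ≤ n → (n : ℕ∞) ≤ N → -lam * φ n ≤ discreteDeriv C φ n)
    (hv : ∀ n : ℕ, 1 ≤ n → (n : ℕ∞) ≤ N → discreteDeriv C v n ≤ -lam * v n + c) (n : ℕ)
    (hn : (n : ℕ∞) ≤ N) : v n ≤ (v 0 - c / lam) * φ n + c / lam := by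
  refine hC.le_of_discreteDeriv_le hlam.le (w := fun k => (v 0 - c / lam) * φ k + c / lam)
    (by simp [hφ0]) hv (fun m hm hmN => ?_) n hn
  rw [discreteDeriv_mul_add, mul_add, neg_mul _ (c / lam), mul_div_cancel₀ _ hlam.ne',
    neg_add_cancel_right, mul_left_comm]
  exact mul_le_mul_of_nonneg_left (hφ m hm hmN) (sub_nonneg.2 h0)

theorem IsMonotoneKernel.mul_add_le_of_subsolution (hC : IsMonotoneKernel N C) (hlam : 0 < lam)
    (h0 : c / lam ≤ v 0) (hφ0 : φ 0 = 1)
    (hφ : ∀ n : ℕ, 1 ≤ n → (n : ℕ∞) ≤ N → discreteDeriv C φ n ≤ -lam * φ n)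
    (hv : ∀ n : ℕ, 1 ≤ n → (n : ℕ∞) ≤ N → -lam * v n + c ≤ discreteDeriv C v n) (n : ℕ)
    (hn : (n : ℕ∞) ≤ N) : (v 0 - c / lam) * φ n + c / lam ≤ v n := by
  refine hC.le_of_discreteDeriv_le hlam.le (u := fun k => (v 0 - c / lam) * φ k + c / lam)
    (by simp [hφ0]) (fun m hm hmN => ?_) hv n hn
  rw [discreteDeriv_mul_add, mul_add, neg_mul _ (c / lam), mul_div_cancel₀ _ hlam.ne',
    neg_add_cancel_right, mul_left_comm]
  exact mul_le_mul_of_nonneg_left (hφ m hm hmN) (sub_nonneg.2 h0)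

end Comparison

end FracGronwall

/-! ### Abel and Mittag-Leffler kernels -/

namespace FracGronwall

open Filter MeasureTheory Set
open scoped Topology

section AbelKernel

variable {β s : ℝ}

theorem abelKernel_of_pos (β : ℝ) (hs : 0 < s) : abelKernel β s = s ^ (β - 1) / Real.Gamma β :=
  if_pos hs

theorem abelKernel_nonneg (hβ : 0 < β) (s : ℝ) : 0 ≤ abelKernel β s := by
  rw [abelKernel]
  have := Real.Gamma_pos_of_pos hβ
  split_ifs with hs <;> positivity

theorem antitoneOn_abelKernel (hβ : 0 < β) (hβ1 : β ≤ 1) : AntitoneOn (abelKernel β) (Ioi 0) := by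
  intro x hx y hy hxy
  have := Real.Gamma_pos_of_pos hβ
  rw [abelKernel_of_pos β hx, abelKernel_of_pos β hy]
  exact div_le_div_of_nonneg_right
    (Real.rpow_le_rpow_of_nonpos hx hxy (by linarith)) this.le

theorem continuousOn_abelKernel (β : ℝ) : ContinuousOn (abelKernel β) (Ioi 0) := by
  refine ContinuousOn.congr (f := fun s => s ^ (β - 1) / Real.Gamma β) ?_
    fun s hs => abelKernel_of_pos β hs
  exact (continuousOn_id.rpow_const fun s hs => Or.inl (ne_of_gt hs)).div_const _

theorem intervalIntegrable_abelKernel (hβ : 0 < β) (x y : ℝ) :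
    IntervalIntegrable (abelKernel β) volume x y := by
  have hpow : IntervalIntegrable (fun s : ℝ => s ^ (β - 1) / Real.Gamma β) volume x y :=
    (intervalIntegral.intervalIntegrable_rpow' (by linarith)).div_const _
  rw [intervalIntegrable_iff] at hpow ⊢
  exact hpow.indicator measurableSet_Ioi

theorem intervalIntegrable_abelKernel_sub (hβ : 0 < β) (T x y : ℝ) :
    IntervalIntegrable (fun s => abelKernel β (T - s)) volume x y := by
  simpa using (intervalIntegrable_abelKernel hβ (T - x) (T - y)).comp_sub_left T

theorem intervalIntegral_reflect (f g : ℝ → ℝ) (T : ℝ) :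
    ∫ s in (0 : ℝ)..T, f s * g (T - s) = ∫ s in (0 : ℝ)..T, g s * f (T - s) := by
  simpa [mul_comm] using
    (intervalIntegral.integral_comp_sub_left (a := 0) (b := T) (fun s => f s * g (T - s)) T).symm

theorem intervalIntegrable_reflect {f g : ℝ → ℝ} {T : ℝ}
    (h : IntervalIntegrable (fun s => f s * g (T - s)) volume 0 T) :
    IntervalIntegrable (fun s => g s * f (T - s)) volume 0 T := by
  simpa [mul_comm] using (h.comp_sub_left T).symm

theorem intervalIntegrable_abelKernel_mul_abelKernel_sub {b c : ℝ} (hb : 0 < b) (hc : 0 < c)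
    {T : ℝ} (hT : 0 < T) :
    IntervalIntegrable (fun s => abelKernel b s * abelKernel c (T - s)) volume 0 T := by
  have key {b : ℝ} (c : ℝ) (hb : 0 < b) :
      IntervalIntegrable (fun s => abelKernel b s * abelKernel c (T - s)) volume 0 (T / 2) := by
    refine (intervalIntegrable_abelKernel hb _ _).mul_continuousOn
      ((continuousOn_abelKernel c).comp (by fun_prop) fun s hs => ?_)
    rw [uIcc_of_le (by linarith)] at hs
    exact mem_Ioi.2 (by linarith [hs.2])
  refine (key c hb).trans ?_
  simpa [mul_comm, sub_half] using ((key b hc).comp_sub_left T).symm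

theorem integral_rpow_mul_sub_rpow {b c T : ℝ} (hb : 0 < b) (hc : 0 < c) (hT : 0 < T) :
    ∫ s in (0 : ℝ)..T, s ^ (b - 1) * (T - s) ^ (c - 1) =
      T ^ (b + c - 1) * (Real.Gamma b * Real.Gamma c / Real.Gamma (b + c)) := by
  have hbeta := Complex.betaIntegral_scaled b c hT
  rw [Complex.betaIntegral_eq_Gamma_mul_div _ _ (by simpa) (by simpa)] at hbeta
  rw [← Complex.ofReal_inj, ← intervalIntegral.integral_ofReal]
  push_cast [Complex.ofReal_cpow hT.le, ← Complex.Gamma_ofReal]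
  rw [← hbeta]
  refine intervalIntegral.integral_congr fun s hs => ?_
  rw [uIcc_of_le hT.le] at hs
  push_cast [Complex.ofReal_cpow hs.1, Complex.ofReal_cpow (sub_nonneg.2 hs.2)]
  rfl

theorem integral_abelKernel_mul_abelKernel_sub {b c : ℝ} (hb : 0 < b) (hc : 0 < c) {T : ℝ}
    (hT : 0 < T) :
    ∫ s in (0 : ℝ)..T, abelKernel b s * abelKernel c (T - s) = abelKernel (b + c) T := by
  have hGb := (Real.Gamma_pos_of_pos hb).ne'
  have hGc := (Real.Gamma_pos_of_pos hc).ne'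
  calc ∫ s in (0 : ℝ)..T, abelKernel b s * abelKernel c (T - s)
      = ∫ s in (0 : ℝ)..T, s ^ (b - 1) * (T - s) ^ (c - 1) / (Real.Gamma b * Real.Gamma c) := by
        refine intervalIntegral.integral_congr_uIoo fun s hs => ?_
        rw [uIoo_of_le hT.le] at hs
        simp only [abelKernel_of_pos _ hs.1, abelKernel_of_pos _ (sub_pos.2 hs.2),
          div_mul_div_comm]
    _ = abelKernel (b + c) T := by
        rw [intervalIntegral.integral_div, integral_rpow_mul_sub_rpow hb hc hT,
          abelKernel_of_pos _ hT]
        field_simp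

end AbelKernel

section MittagLeffler

theorem Gamma_mul_rpow_le_Gamma_add {x a : ℝ} (hx : 1 < x) (ha : 0 < a) :
    Real.Gamma x * (x - 1) ^ a ≤ Real.Gamma (x + a) := by
  have hx1 : 0 < x - 1 := by linarith
  have hG : 0 < Real.Gamma (x - 1) := Real.Gamma_pos_of_pos hx1
  have hG' : 0 < Real.Gamma (x + a) := Real.Gamma_pos_of_pos (by linarith)
  have hrec : Real.Gamma x = (x - 1) * Real.Gamma (x - 1) := by
    simpa using Real.Gamma_add_one hx1.ne'
  have hslope := Real.convexOn_log_Gamma.slope_mono_adjacent (x := x - 1) (y := x) (z := x + a)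
    hx1 (mem_Ioi.2 (by linarith)) (by linarith) (by linarith)
  simp only [Function.comp_apply, sub_sub_cancel, add_sub_cancel_left, div_one, hrec,
    Real.log_mul hx1.ne' hG.ne', add_sub_cancel_right, le_div_iff₀ ha] at hslope
  rw [hrec, ← Real.log_le_log_iff (by positivity) hG', Real.log_mul (by positivity) (by positivity),
    Real.log_mul hx1.ne' hG.ne', Real.log_rpow hx1]
  linarith

theorem summable_mittagLeffler₂ {a : ℝ} (ha : 0 < a) (b z : ℝ) :
    Summable fun k : ℕ => z ^ k / Real.Gamma (a * k + b) := by
  refine summable_of_ratio_norm_eventually_le (r := 1 / 2) (by norm_num) ?_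
  have harg : Tendsto (fun k : ℕ => a * (k : ℝ) + b) atTop atTop :=
    tendsto_atTop_add_const_right _ _ (tendsto_natCast_atTop_atTop.const_mul_atTop ha)
  have hpow : Tendsto (fun k : ℕ => (a * (k : ℝ) + b - 1) ^ a) atTop atTop :=
    (tendsto_rpow_atTop ha).comp (tendsto_atTop_add_const_right _ (-1) harg)
  filter_upwards [harg.eventually_gt_atTop 1, hpow.eventually_ge_atTop (2 * |z|)] with k hk hkz
  have hG : 0 < Real.Gamma (a * k + b) := Real.Gamma_pos_of_pos (by linarith)
  have hG' : 0 < Real.Gamma (a * k + b + a) := Real.Gamma_pos_of_pos (by linarith)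
  have hgrow : Real.Gamma (a * k + b) * (2 * |z|) ≤ Real.Gamma (a * k + b + a) :=
    (mul_le_mul_of_nonneg_left hkz hG.le).trans (Gamma_mul_rpow_le_Gamma_add hk ha)
  rw [show a * ((k + 1 : ℕ) : ℝ) + b = a * k + b + a by push_cast; ring, norm_div, norm_div,
    norm_pow, norm_pow, Real.norm_eq_abs, Real.norm_of_nonneg hG.le, Real.norm_of_nonneg hG'.le,
    div_le_iff₀ hG', pow_succ]
  calc |z| ^ k * |z| = 1 / 2 * (|z| ^ k / Real.Gamma (a * k + b)) *
        (Real.Gamma (a * k + b) * (2 * |z|)) := by field_simp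
    _ ≤ _ := by gcongr

variable {a b : ℝ}

theorem hasSum_mittagLeffler₂ (ha : 0 < a) (b z : ℝ) :
    HasSum (fun k : ℕ => z ^ k / Real.Gamma (a * k + b)) (mittagLeffler₂ a b z) :=
  (summable_mittagLeffler₂ ha b z).hasSum

theorem continuous_mittagLeffler₂ (ha : 0 < a) (hb : 0 < b) : Continuous (mittagLeffler₂ a b) := by
  refine continuous_iff_continuousAt.2 fun z => ?_
  have hnhds : Icc (-(|z| + 1)) (|z| + 1) ∈ 𝓝 z :=
    Icc_mem_nhds (by linarith [neg_abs_le z]) (by linarith [le_abs_self z])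
  refine ContinuousOn.continuousAt ?_ hnhds
  refine continuousOn_tsum (fun k => by fun_prop) (summable_mittagLeffler₂ ha b (|z| + 1)) ?_
  intro k x hx
  have hG : 0 < Real.Gamma (a * k + b) := Real.Gamma_pos_of_pos (by positivity)
  have hxz := abs_le.2 hx
  rw [norm_div, norm_pow, Real.norm_eq_abs, Real.norm_of_nonneg hG.le]
  gcongr

theorem mittagLeffler₂_eq_add (ha : 0 < a) (b z : ℝ) :
    mittagLeffler₂ a b z = 1 / Real.Gamma b + z * mittagLeffler₂ a (a + b) z := by
  rw [mittagLeffler₂, (summable_mittagLeffler₂ ha b z).tsum_eq_zero_add, mittagLeffler₂,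
    ← tsum_mul_left]
  congr 1
  · simp
  · refine tsum_congr fun k => ?_
    rw [show a * ((k + 1 : ℕ) : ℝ) + b = a * k + (a + b) by push_cast; ring, pow_succ]
    ring

theorem mittagLeffler₂_zero (ha : 0 < a) (b : ℝ) : mittagLeffler₂ a b 0 = 1 / Real.Gamma b := by
  rw [mittagLeffler₂_eq_add ha, zero_mul, add_zero]

end MittagLeffler

/-- The Mittag-Leffler kernel `s ↦ s^(b-1) E_{a,b}(x s^a)`, the sum `∑ xᵏ g_{ak+b}(s)` of Abel
kernels for `s > 0`. For `b = a` and `x = -μ` it is (up to the factor `μ`) the resolvent of the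
Abel kernel `μ g_a`, and for `b = 1` it is `E_a(x s^a)`. -/
noncomputable def mittagLefflerKernel (a b x s : ℝ) : ℝ :=
  s ^ (b - 1) * mittagLeffler₂ a b (x * s ^ a)

section MittagLefflerKernel

variable {a b x y T : ℝ}

theorem abelKernel_mul_natCast_add (a b : ℝ) (k : ℕ) {s : ℝ} (hs : 0 < s) :
    abelKernel (a * k + b) s = (s ^ a) ^ k / Real.Gamma (a * k + b) * s ^ (b - 1) := by
  rw [abelKernel_of_pos _ hs, add_sub_assoc, Real.rpow_add hs, Real.rpow_mul_natCast hs.le]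
  ring

theorem hasSum_mittagLefflerKernel (ha : 0 < a) (b x : ℝ) {s : ℝ} (hs : 0 < s) :
    HasSum (fun k : ℕ => x ^ k * abelKernel (a * k + b) s) (mittagLefflerKernel a b x s) := by
  refine ((hasSum_mittagLeffler₂ ha b (x * s ^ a)).mul_left (s ^ (b - 1))).congr_fun fun k => ?_
  rw [abelKernel_mul_natCast_add a b k hs, mul_pow]
  ring

theorem mittagLefflerKernel_eq_add (ha : 0 < a) (b x : ℝ) {s : ℝ} (hs : 0 < s) :
    mittagLefflerKernel a b x s = abelKernel b s + x * mittagLefflerKernel a (a + b) x s := by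
  rw [mittagLefflerKernel, mittagLeffler₂_eq_add ha, mittagLefflerKernel, abelKernel_of_pos b hs,
    add_sub_assoc, Real.rpow_add hs]
  ring

theorem continuous_mittagLeffler₂_comp_rpow (ha : 0 < a) (hb : 0 < b) (x : ℝ) :
    Continuous fun s : ℝ => mittagLeffler₂ a b (x * s ^ a) :=
  (continuous_mittagLeffler₂ ha hb).comp
    (continuous_const.mul (Real.continuous_rpow_const ha.le))

theorem intervalIntegrable_rpow_mul_of_abelKernel_mul (hb : 0 < b) (hT : 0 ≤ T) {f : ℝ → ℝ}
    (hf : IntervalIntegrable (fun s => abelKernel b s * f s) volume 0 T) :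
    IntervalIntegrable (fun s => s ^ (b - 1) * f s) volume 0 T := by
  refine (hf.const_mul (Real.Gamma b)).congr_uIoo fun s hs => ?_
  rw [uIoo_of_le hT] at hs
  have := (Real.Gamma_pos_of_pos hb).ne'
  simp only [abelKernel_of_pos b hs.1]
  field_simp

theorem intervalIntegrable_mittagLefflerKernel_mul (ha : 0 < a) (hb : 0 < b) (x : ℝ) (hT : 0 ≤ T)
    {f : ℝ → ℝ} (hf : IntervalIntegrable (fun s => abelKernel b s * f s) volume 0 T) :
    IntervalIntegrable (fun s => mittagLefflerKernel a b x s * f s) volume 0 T := by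
  simpa only [mittagLefflerKernel, mul_right_comm] using
    (intervalIntegrable_rpow_mul_of_abelKernel_mul hb hT hf).mul_continuousOn
      (continuous_mittagLeffler₂_comp_rpow ha hb x).continuousOn

theorem hasSum_integral_mittagLefflerKernel_mul (ha : 0 < a) (hb : 0 < b) (x : ℝ) (hT : 0 ≤ T)
    {f : ℝ → ℝ} (hf : IntervalIntegrable (fun s => abelKernel b s * f s) volume 0 T) :
    HasSum (fun k : ℕ => x ^ k * ∫ s in (0 : ℝ)..T, abelKernel (a * k + b) s * f s)
      (∫ s in (0 : ℝ)..T, mittagLefflerKernel a b x s * f s) := by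
  have hpow := intervalIntegrable_rpow_mul_of_abelKernel_mul hb hT hf
  have hterm (k : ℕ) {s : ℝ} (hs : s ∈ uIoc 0 T) : x ^ k * (abelKernel (a * k + b) s * f s) =
      (x * s ^ a) ^ k / Real.Gamma (a * k + b) * (s ^ (b - 1) * f s) := by
    rw [uIoc_of_le hT] at hs
    rw [abelKernel_mul_natCast_add a b k hs.1]
    ring
  simp only [← intervalIntegral.integral_const_mul]
  refine intervalIntegral.hasSum_integral_of_dominated_convergence
    (fun k s => (‖x‖ * T ^ a) ^ k / Real.Gamma (a * k + b) * |s ^ (b - 1) * f s|)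
    (fun k => ?_) (fun k => .of_forall fun s hs => ?_)
    (.of_forall fun s _ => (summable_mittagLeffler₂ ha b _).mul_right _) ?_
    (.of_forall fun s hs => ?_)
  · refine AEStronglyMeasurable.congr ?_ ((ae_restrict_mem measurableSet_uIoc).mono
      fun s hs => (hterm k hs).symm)
    have hmeas : Continuous fun s : ℝ => (x * s ^ a) ^ k / Real.Gamma (a * k + b) :=
      ((continuous_const.mul (Real.continuous_rpow_const ha.le)).pow k).div_const _
    exact hmeas.aestronglyMeasurable.mul hpow.def'.aestronglyMeasurable
  · have hG : 0 < Real.Gamma (a * k + b) := Real.Gamma_pos_of_pos (by positivity)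
    rw [hterm k hs, norm_mul, norm_div, norm_pow, norm_mul, Real.norm_of_nonneg hG.le]
    rw [uIoc_of_le hT] at hs
    have hs0 : 0 ≤ s := hs.1.le
    rw [Real.norm_of_nonneg (Real.rpow_nonneg hs0 a), ← Real.norm_eq_abs (_ * f s)]
    gcongr
    exact hs.2
  · simp only [tsum_mul_right]
    exact hpow.abs.const_mul _
  · rw [uIoc_of_le hT] at hs
    simpa only [mul_assoc] using (hasSum_mittagLefflerKernel ha b x hs.1).mul_right (f s)

theorem integral_mittagLefflerKernel_mul_abelKernel_sub (ha : 0 < a) (hb : 0 < b) {c : ℝ}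
    (hc : 0 < c) (x : ℝ) (hT : 0 < T) :
    ∫ s in (0 : ℝ)..T, mittagLefflerKernel a b x s * abelKernel c (T - s) =
      mittagLefflerKernel a (b + c) x T := by
  refine (hasSum_integral_mittagLefflerKernel_mul ha hb x hT.le
    (intervalIntegrable_abelKernel_mul_abelKernel_sub hb hc hT)).unique ?_
  refine (hasSum_mittagLefflerKernel ha (b + c) x hT).congr_fun fun k => ?_
  rw [integral_abelKernel_mul_abelKernel_sub (by positivity) hc hT, add_assoc]

theorem sub_mul_integral_mittagLefflerKernel (ha : 0 < a) (hb : 0 < b) (x y : ℝ) (hT : 0 < T) :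
    (x - y) * ∫ s in (0 : ℝ)..T, mittagLefflerKernel a b x s * mittagLefflerKernel a a y (T - s) =
      mittagLefflerKernel a b x T - mittagLefflerKernel a b y T := by
  -- Expanding the second factor in powers of `y` gives `I = ∑ y ^ k * S (k + 1)`, and
  -- `x * S (k + 1) = S k - abelKernel (a * k + b) T`.
  set S : ℕ → ℝ := fun k => mittagLefflerKernel a (a * k + b) x T with hS
  set I := ∫ s in (0 : ℝ)..T, mittagLefflerKernel a b x s * mittagLefflerKernel a a y (T - s)
  have hI : HasSum (fun k : ℕ => y ^ k * S (k + 1)) I := by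
    have hint := intervalIntegrable_reflect (intervalIntegrable_mittagLefflerKernel_mul ha hb x
      hT.le (intervalIntegrable_abelKernel_mul_abelKernel_sub hb ha hT))
    have hsum := hasSum_integral_mittagLefflerKernel_mul ha ha y hT.le hint
    rw [← intervalIntegral_reflect] at hsum
    refine hsum.congr_fun fun k => ?_
    rw [intervalIntegral_reflect, integral_mittagLefflerKernel_mul_abelKernel_sub ha hb
      (by positivity) x hT, show b + (a * k + a) = a * (k + 1 : ℕ) + b by push_cast; ring]
  have hshift : HasSum (fun k : ℕ => y ^ k * S k) (S 0 + y * I) := by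
    refine (hasSum_nat_add_iff' 1).1 ?_
    simpa [pow_succ', mul_assoc] using hI.mul_left y
  have hrec (k : ℕ) : x * S (k + 1) = S k - abelKernel (a * k + b) T := by
    simp only [hS, mittagLefflerKernel_eq_add ha (a * k + b) x hT, Nat.cast_add_one,
      show a * ((k : ℝ) + 1) + b = a + (a * k + b) by ring, add_sub_cancel_left]
  have hxI : HasSum (fun k : ℕ => x * (y ^ k * S (k + 1)))
      (S 0 + y * I - mittagLefflerKernel a b y T) := by
    refine (hshift.sub (hasSum_mittagLefflerKernel ha b y hT)).congr_fun fun k => ?_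
    rw [mul_left_comm, hrec]
    ring
  have hS0 : S 0 = mittagLefflerKernel a b x T := by simp [hS]
  linarith [(hI.mul_left x).unique hxI]

end MittagLefflerKernel

end FracGronwall

/-! ### Positivity and decay of `E_{a,a}` on the negative axis -/

namespace FracGronwall

open MeasureTheory Set
open scoped Topology

section Positivity

variable {a s t T x y : ℝ}

theorem mittagLeffler₂_neg_le_of_nonneg (ha : 0 < a) (hx : 0 ≤ x) (hxy : x ≤ y)
    (h : ∀ z, 0 ≤ z → z < y → 0 ≤ mittagLeffler₂ a a (-z)) :
    mittagLeffler₂ a a (-y) ≤ mittagLeffler₂ a a (-x) := by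
  obtain rfl | hlt := hxy.eq_or_lt
  · rfl
  have hkernel {w s : ℝ} (hw : 0 ≤ w) (hs : 0 ≤ s) (hws : w * s ^ a < y) :
      0 ≤ mittagLefflerKernel a a (-w) s := by
    rw [mittagLefflerKernel, neg_mul]
    exact mul_nonneg (Real.rpow_nonneg hs _) (h _ (by positivity) hws)
  have hint : 0 ≤ ∫ s in (0 : ℝ)..1,
      mittagLefflerKernel a a (-x) s * mittagLefflerKernel a a (-y) (1 - s) := by
    rw [intervalIntegral.integral_of_le zero_le_one, integral_Ioc_eq_integral_Ioo]
    refine setIntegral_nonneg measurableSet_Ioo fun s hs => mul_nonneg ?_ ?_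
    · exact hkernel hx hs.1.le
        ((mul_le_of_le_one_right hx (Real.rpow_le_one hs.1.le hs.2.le ha.le)).trans_lt hlt)
    · exact hkernel (hx.trans hxy) (sub_nonneg.2 hs.2.le) (mul_lt_of_lt_one_right (hx.trans_lt hlt)
        (Real.rpow_lt_one (sub_nonneg.2 hs.2.le) (by linarith [hs.1]) ha))
  have hres := sub_mul_integral_mittagLefflerKernel ha ha (-x) (-y) zero_lt_one
  have hone (z : ℝ) : mittagLefflerKernel a a z 1 = mittagLeffler₂ a a z := by
    simp [mittagLefflerKernel]
  rw [hone, hone] at hres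
  nlinarith

theorem mittagLeffler₂_neg_rpow_eq (ha : 0 < a) (hT : 0 < T) :
    mittagLeffler₂ a a (-T ^ a) = 1 / Real.Gamma a -
      T ^ (1 - a) * ∫ s in (0 : ℝ)..T, mittagLefflerKernel a a (-1) s * abelKernel a (T - s) := by
  rw [integral_mittagLefflerKernel_mul_abelKernel_sub ha ha ha _ hT, mittagLefflerKernel,
    mittagLeffler₂_eq_add ha, ← mul_assoc, ← Real.rpow_add hT]
  ring_nf

theorem integral_abelKernel_sub {b : ℝ} (hb : 0 < b) (htT : t ≤ T) :
    ∫ s in t..T, abelKernel b (T - s) = (T - t) ^ b / Real.Gamma (b + 1) := by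
  rw [intervalIntegral.integral_comp_sub_left, sub_self, Real.Gamma_add_one hb.ne']
  have hpow : ∫ s in (0 : ℝ)..T - t, abelKernel b s =
      ∫ s in (0 : ℝ)..T - t, s ^ (b - 1) / Real.Gamma b := by
    refine intervalIntegral.integral_congr_uIoo fun s hs => ?_
    rw [uIoo_of_le (sub_nonneg.2 htT)] at hs
    exact abelKernel_of_pos b hs.1
  rw [hpow, intervalIntegral.integral_div, integral_rpow (Or.inl (by linarith)), sub_add_cancel,
    Real.zero_rpow hb.ne', sub_zero, div_div]

theorem rpow_mul_abelKernel (b : ℝ) (hT : 0 ≤ T) (hs : 0 < s) :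
    T ^ (1 - b) * abelKernel b s = (T / s) ^ (1 - b) / Real.Gamma b := by
  rw [abelKernel_of_pos b hs, Real.div_rpow hT hs.le, ← neg_sub 1 b, Real.rpow_neg hs.le]
  ring

theorem rpow_mul_abelKernel_sub_le (ha : 0 < a) (ha1 : a ≤ 1) (hs : 0 ≤ s) (hst : s < t)
    (htT : t ≤ T) :
    T ^ (1 - a) * abelKernel a (T - s) ≤ t ^ (1 - a) * abelKernel a (t - s) := by
  have hTs : 0 < T - s := by linarith
  have hts : 0 < t - s := by linarith
  have hratio : T / (T - s) ≤ t / (t - s) := by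
    rw [div_le_div_iff₀ hTs hts]
    nlinarith
  have := Real.Gamma_pos_of_pos ha
  rw [rpow_mul_abelKernel a (by linarith) hTs, rpow_mul_abelKernel a (by linarith) hts]
  have h0 : 0 ≤ T / (T - s) := div_nonneg (by linarith) hTs.le
  have : 0 ≤ 1 - a := by linarith
  gcongr

theorem rpow_mul_rpow_mul_abelKernel_sub_le (ha : 0 < a) (ha1 : a ≤ 1) (hs : 0 < s) (hsT : s < T) :
    T ^ (1 - a) * (s ^ (a - 1) * abelKernel a (T - s)) ≤
      abelKernel a s + abelKernel a (T - s) := by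
  have hTs : 0 < T - s := sub_pos.2 hsT
  have hT : 0 < T := hs.trans hsT
  have hinv (u : ℝ) (hu : 0 < u) : u ^ (a - 1) = u⁻¹ ^ (1 - a) := by
    rw [← neg_sub, Real.rpow_neg hu.le, Real.inv_rpow hu.le]
  -- `u ↦ u ^ (1 - a)` is subadditive, and `s⁻¹ + (T - s)⁻¹ = T * (s⁻¹ * (T - s)⁻¹)`.
  have hsub := Real.rpow_add_le_add_rpow (inv_nonneg.2 hs.le) (inv_nonneg.2 hTs.le)
    (sub_nonneg.2 ha1) (by linarith)
  have hsum : s⁻¹ + (T - s)⁻¹ = T * (s⁻¹ * (T - s)⁻¹) := by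
    field_simp
    ring
  rw [hsum, Real.mul_rpow hT.le (by positivity), Real.mul_rpow (by positivity) (by positivity)]
    at hsub
  have := Real.Gamma_pos_of_pos ha
  rw [abelKernel_of_pos a hs, abelKernel_of_pos a hTs, ← add_div, mul_div_assoc', mul_div_assoc',
    hinv s hs, hinv _ hTs]
  gcongr

theorem intervalIntegrable_rpow_mul_abelKernel_sub {c : ℝ} (b : ℝ) (hc : 0 < c) (ht : 0 < t)
    (htT : t ≤ T) :
    IntervalIntegrable (fun s => s ^ (b - 1) * abelKernel c (T - s)) volume t T := by
  refine (intervalIntegrable_abelKernel_sub hc T t T).continuousOn_mul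
    (continuousOn_id.rpow_const fun s hs => Or.inl ?_)
  rw [uIcc_of_le htT] at hs
  exact (ht.trans_le hs.1).ne'

theorem rpow_mul_integral_rpow_mul_abelKernel_sub_le (ha : 0 < a) (ha1 : a ≤ 1) (ht : 0 < t)
    (htT : t ≤ T) :
    T ^ (1 - a) * ∫ s in t..T, s ^ (a - 1) * abelKernel a (T - s) ≤
      2 * (T - t) ^ a / Real.Gamma (a + 1) := by
  have hg := intervalIntegrable_abelKernel_sub ha T t T
  have hg' : IntervalIntegrable (fun s => abelKernel a (s - t)) volume t T := by
    simpa using (intervalIntegrable_abelKernel ha (t - t) (T - t)).comp_sub_right t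
  have hrefl : ∫ s in t..T, abelKernel a (s - t) = ∫ s in t..T, abelKernel a (T - s) := by
    simp [intervalIntegral.integral_comp_sub_left, intervalIntegral.integral_comp_sub_right]
  calc T ^ (1 - a) * ∫ s in t..T, s ^ (a - 1) * abelKernel a (T - s)
      ≤ ∫ s in t..T, (abelKernel a (s - t) + abelKernel a (T - s)) := by
        rw [← intervalIntegral.integral_const_mul]
        refine intervalIntegral.integral_mono_on_of_le_Ioo htT
          ((intervalIntegrable_rpow_mul_abelKernel_sub a ha ht htT).const_mul _) (hg'.add hg)
          fun s hs => ?_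
        refine (rpow_mul_rpow_mul_abelKernel_sub_le ha ha1 (ht.trans hs.1) hs.2).trans ?_
        gcongr
        exact antitoneOn_abelKernel ha ha1 (sub_pos.2 hs.1) (ht.trans hs.1) (by linarith)
    _ = 2 * (T - t) ^ a / Real.Gamma (a + 1) := by
        rw [intervalIntegral.integral_add hg' hg, hrefl, integral_abelKernel_sub ha htT]
        ring

theorem intervalIntegrable_mittagLefflerKernel_mul_abelKernel_sub {b c : ℝ} (ha : 0 < a)
    (hb : 0 < b) (hc : 0 < c) (z : ℝ) (hx : 0 ≤ x) (hxy : x ≤ y) (hy : y ≤ T) :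
    IntervalIntegrable (fun s => mittagLefflerKernel a b z s * abelKernel c (T - s))
      volume x y := by
  obtain hT | hT := (hx.trans (hxy.trans hy)).eq_or_lt
  · rw [show x = y by linarith]
  refine (intervalIntegrable_mittagLefflerKernel_mul ha hb z hT.le
    (intervalIntegrable_abelKernel_mul_abelKernel_sub hb hc hT)).mono_set ?_
  rw [uIcc_of_le hxy, uIcc_of_le hT.le]
  exact Icc_subset_Icc hx hy

theorem mittagLeffler₂_neg_rpow_le_add (ha : 0 < a) (ha1 : a ≤ 1) (ht : 0 < t) (htT : t ≤ T)
    (h : ∀ z, 0 ≤ z → z < T ^ a → 0 ≤ mittagLeffler₂ a a (-z)) :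
    mittagLeffler₂ a a (-t ^ a) ≤ mittagLeffler₂ a a (-T ^ a) +
      T ^ (1 - a) * ∫ s in t..T, mittagLefflerKernel a a (-1) s * abelKernel a (T - s) := by
  have hint {x y u : ℝ} := intervalIntegrable_mittagLefflerKernel_mul_abelKernel_sub (x := x)
    (y := y) (T := u) ha ha ha (-1)
  have hle : T ^ (1 - a) * ∫ s in (0 : ℝ)..t, mittagLefflerKernel a a (-1) s * abelKernel a (T - s)
      ≤ t ^ (1 - a) * ∫ s in (0 : ℝ)..t, mittagLefflerKernel a a (-1) s * abelKernel a (t - s) := by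
    simp only [← intervalIntegral.integral_const_mul]
    refine intervalIntegral.integral_mono_on_of_le_Ioo ht.le ((hint le_rfl ht.le htT).const_mul _)
      ((hint le_rfl ht.le le_rfl).const_mul _) fun s hs => ?_
    have hs0 := hs.1.le
    have hnonneg : 0 ≤ mittagLefflerKernel a a (-1) s := by
      rw [mittagLefflerKernel, neg_one_mul]
      exact mul_nonneg (Real.rpow_nonneg hs0 _) (h _ (Real.rpow_nonneg hs0 a)
        (Real.rpow_lt_rpow hs0 (hs.2.trans_le htT) ha))
    rw [mul_left_comm, mul_left_comm (t ^ (1 - a))]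
    exact mul_le_mul_of_nonneg_left (rpow_mul_abelKernel_sub_le ha ha1 hs0 hs.2 htT) hnonneg
  rw [mittagLeffler₂_neg_rpow_eq ha ht, mittagLeffler₂_neg_rpow_eq ha (ht.trans_le htT),
    ← intervalIntegral.integral_add_adjacent_intervals (hint le_rfl ht.le htT)
      (hint ht.le htT le_rfl)]
  linarith

theorem mittagLeffler₂_neg_rpow_mul_le (ha : 0 < a) (ha1 : a ≤ 1) (ht : 0 < t) (htT : t ≤ T)
    (h : ∀ z, 0 ≤ z → z < T ^ a → 0 ≤ mittagLeffler₂ a a (-z)) :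
    mittagLeffler₂ a a (-t ^ a) * (1 - 2 * (T - t) ^ a / Real.Gamma (a + 1)) ≤
      mittagLeffler₂ a a (-T ^ a) := by
  obtain rfl | hlt := htT.eq_or_lt
  · simp [Real.zero_rpow ha.ne']
  have hT0 : 0 ≤ T := ht.le.trans htT
  have hPt := h _ (Real.rpow_nonneg ht.le a) (Real.rpow_lt_rpow ht.le hlt ha)
  have hle : ∫ s in t..T, mittagLefflerKernel a a (-1) s * abelKernel a (T - s) ≤
      mittagLeffler₂ a a (-t ^ a) * ∫ s in t..T, s ^ (a - 1) * abelKernel a (T - s) := by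
    rw [← intervalIntegral.integral_const_mul]
    refine intervalIntegral.integral_mono_on_of_le_Ioo htT
      (intervalIntegrable_mittagLefflerKernel_mul_abelKernel_sub ha ha ha _ ht.le htT le_rfl)
      ((intervalIntegrable_rpow_mul_abelKernel_sub a ha ht htT).const_mul _)
      fun s hs => ?_
    have hs0 := ht.le.trans hs.1.le
    have hanti : mittagLeffler₂ a a (-s ^ a) ≤ mittagLeffler₂ a a (-t ^ a) :=
      mittagLeffler₂_neg_le_of_nonneg ha (by positivity) (by gcongr; exact hs.1.le) fun z hz hzs =>
        h z hz (hzs.trans (Real.rpow_lt_rpow hs0 hs.2 ha))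
    have := abelKernel_nonneg ha (T - s)
    rw [mittagLefflerKernel, neg_one_mul, ← mul_assoc, mul_comm (s ^ _)]
    gcongr
  calc mittagLeffler₂ a a (-t ^ a) * (1 - 2 * (T - t) ^ a / Real.Gamma (a + 1))
      ≤ mittagLeffler₂ a a (-t ^ a) *
          (1 - T ^ (1 - a) * ∫ s in t..T, s ^ (a - 1) * abelKernel a (T - s)) := by
        gcongr
        exact rpow_mul_integral_rpow_mul_abelKernel_sub_le ha ha1 ht htT
    _ ≤ mittagLeffler₂ a a (-T ^ a) := by
        have := mul_le_mul_of_nonneg_left hle (Real.rpow_nonneg hT0 (1 - a))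
        linarith [mittagLeffler₂_neg_rpow_le_add ha ha1 ht htT h]

theorem mittagLeffler₂_neg_pos (ha : 0 < a) (ha1 : a ≤ 1) (hx : 0 ≤ x) :
    0 < mittagLeffler₂ a a (-x) := by
  -- `T ^ a` is the first zero; the decay estimate just to its left contradicts its existence.
  by_contra! hneg
  have hcont : Continuous fun z => mittagLeffler₂ a a (-z) :=
    (continuous_mittagLeffler₂ ha ha).comp continuous_neg
  set S : Set ℝ := Ici 0 ∩ {z | mittagLeffler₂ a a (-z) ≤ 0}
  have hSclosed : IsClosed S := isClosed_Ici.inter (isClosed_le hcont continuous_const)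
  have hSbdd : BddBelow S := ⟨0, fun z hz => hz.1⟩
  obtain ⟨hy0, hyneg⟩ := hSclosed.csInf_mem ⟨x, hx, hneg⟩ hSbdd
  have hpos (z : ℝ) (hz : 0 ≤ z) (hzy : z < sInf S) : 0 < mittagLeffler₂ a a (-z) := by
    by_contra! hz'
    exact hzy.not_ge (csInf_le hSbdd ⟨hz, hz'⟩)
  set T := sInf S ^ a⁻¹ with hT
  have hTa : T ^ a = sInf S := Real.rpow_inv_rpow hy0 ha.ne'
  have hT0 : 0 < T := by
    refine Real.rpow_pos_of_pos (lt_of_le_of_ne hy0 fun h0 => ?_) _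
    rw [mem_ofPred_eq, ← h0, neg_zero, mittagLeffler₂_zero ha] at hyneg
    exact hyneg.not_gt (one_div_pos.2 (Real.Gamma_pos_of_pos ha))
  obtain ⟨t, ht, htT, hsmall⟩ : ∃ t, 0 < t ∧ t < T ∧ 2 * (T - t) ^ a < Real.Gamma (a + 1) := by
    have hlim : ContinuousAt (fun t => 2 * (T - t) ^ a) T := by fun_prop (disch := simp [ha.le])
    have hev : ∀ᶠ t in 𝓝[<] T, 2 * (T - t) ^ a < Real.Gamma (a + 1) := by
      refine (hlim.eventually_lt_const ?_).filter_mono nhdsWithin_le_nhds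
      simpa [Real.zero_rpow ha.ne'] using Real.Gamma_pos_of_pos (by linarith)
    obtain ⟨t, ⟨hsmall, ht⟩⟩ := (hev.and (Ioo_mem_nhdsLT hT0)).exists
    exact ⟨t, ht.1, ht.2, hsmall⟩
  have hdecay := mittagLeffler₂_neg_rpow_mul_le ha ha1 ht htT.le fun z hz hzT =>
    (hpos z hz (hTa ▸ hzT)).le
  have hPt := hpos _ (Real.rpow_nonneg ht.le a) (hTa ▸ Real.rpow_lt_rpow ht.le htT ha)
  have hfactor : 0 < 1 - 2 * (T - t) ^ a / Real.Gamma (a + 1) :=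
    sub_pos.2 ((div_lt_one (Real.Gamma_pos_of_pos (by linarith))).2 hsmall)
  rw [hTa] at hdecay
  exact (mul_pos hPt hfactor).not_ge (hdecay.trans hyneg)

theorem mittagLeffler₂_neg_anti (ha : 0 < a) (ha1 : a ≤ 1) (hx : 0 ≤ x) (hxy : x ≤ y) :
    mittagLeffler₂ a a (-y) ≤ mittagLeffler₂ a a (-x) :=
  mittagLeffler₂_neg_le_of_nonneg ha hx hxy fun _ hz _ => (mittagLeffler₂_neg_pos ha ha1 hz).le

theorem half_le_Gamma_add_one (ha : 0 < a) (ha1 : a ≤ 1) : 1 / 2 ≤ Real.Gamma (a + 1) := by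
  have hrec : Real.Gamma (a + 2) = (a + 1) * Real.Gamma (a + 1) := by
    rw [← Real.Gamma_add_one (by linarith), add_assoc, one_add_one_eq_two]
  have hmono : Real.Gamma 2 ≤ Real.Gamma (a + 2) :=
    Real.Gamma_strictMonoOn_Ici.monotoneOn (mem_Ici.2 le_rfl) (mem_Ici.2 (by linarith))
      (by linarith)
  rw [Real.Gamma_two, hrec] at hmono
  nlinarith [Real.Gamma_pos_of_pos (show 0 < a + 1 by linarith)]

theorem mittagLeffler₂_neg_rpow_le_two_mul (ha : 0 < a) (ha1 : a ≤ 1) (ht : 0 < t) (htT : t ≤ T)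
    (hTt : (T - t) ^ a ≤ 1 / 8) :
    mittagLeffler₂ a a (-t ^ a) ≤ 2 * mittagLeffler₂ a a (-T ^ a) := by
  have hdecay := mittagLeffler₂_neg_rpow_mul_le ha ha1 ht htT fun z hz _ =>
    (mittagLeffler₂_neg_pos ha ha1 hz).le
  have hG := half_le_Gamma_add_one ha ha1
  have hratio : 2 * (T - t) ^ a / Real.Gamma (a + 1) ≤ 1 / 2 := by
    rw [div_le_iff₀ (by linarith)]
    linarith
  nlinarith [mittagLeffler₂_neg_pos ha ha1 (Real.rpow_nonneg ht.le a)]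

theorem mittagLeffler₂_neg_rpow_le_two_pow_mul (ha : 1 / 2 ≤ a) (ha1 : a ≤ 1) (ht : 0 < t)
    (htT : t ≤ T) (hTt : T - t ≤ 1) :
    mittagLeffler₂ a a (-t ^ a) ≤ 2 ^ 64 * mittagLeffler₂ a a (-T ^ a) := by
  have ha0 : 0 < a := by linarith
  -- The step `(T - t) / 64` satisfies the previous lemma for all `a ≥ 1/2`, as `64 ^ (1/2) = 8`.
  set δ := (T - t) / 64 with hδ
  have : 0 ≤ δ := div_nonneg (sub_nonneg.2 htT) (by norm_num)
  have hδa : δ ^ a ≤ 1 / 8 :=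
    calc δ ^ a ≤ (1 / 64) ^ a := by gcongr; linarith
      _ ≤ (1 / 64) ^ (1 / 2 : ℝ) :=
        Real.rpow_le_rpow_of_exponent_ge (by norm_num) (by norm_num) ha
      _ = 1 / 8 := by
        rw [← Real.sqrt_eq_rpow, Real.sqrt_eq_iff_mul_self_eq (by norm_num) (by norm_num)]
        norm_num
  have hsteps (m : ℕ) :
      mittagLeffler₂ a a (-t ^ a) ≤ 2 ^ m * mittagLeffler₂ a a (-(t + m * δ) ^ a) := by
    induction m with
    | zero => simp
    | succ m ih =>
      have hstep := mittagLeffler₂_neg_rpow_le_two_mul ha0 ha1 (t := t + m * δ)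
        (T := t + (m + 1 : ℕ) * δ) (by positivity) (by push_cast; linarith)
        (by convert hδa using 2; push_cast; ring)
      calc mittagLeffler₂ a a (-t ^ a) ≤ 2 ^ m * mittagLeffler₂ a a (-(t + m * δ) ^ a) := ih
        _ ≤ 2 ^ m * (2 * mittagLeffler₂ a a (-(t + (m + 1 : ℕ) * δ) ^ a)) := by gcongr
        _ = 2 ^ (m + 1) * mittagLeffler₂ a a (-(t + (m + 1 : ℕ) * δ) ^ a) := by ring
  have hend : t + (64 : ℕ) * δ = T := by
    rw [hδ]
    push_cast
    ring
  simpa only [hend] using hsteps 64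

end Positivity

section Kernel

variable {a μ s t : ℝ}

theorem mittagLefflerKernel_neg_nonneg (ha : 0 < a) (ha1 : a ≤ 1) (hμ : 0 ≤ μ) (hs : 0 ≤ s) :
    0 ≤ mittagLefflerKernel a a (-μ) s := by
  rw [mittagLefflerKernel, neg_mul]
  exact mul_nonneg (Real.rpow_nonneg hs _) (mittagLeffler₂_neg_pos ha ha1 (by positivity)).le

theorem antitoneOn_mittagLefflerKernel_neg (ha : 0 < a) (ha1 : a ≤ 1) (hμ : 0 ≤ μ) :
    AntitoneOn (mittagLefflerKernel a a (-μ)) (Ioi 0) := by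
  intro s hs t ht hst
  have hs0 : 0 < s := hs
  have ht0 : 0 < t := ht
  simp only [mittagLefflerKernel, neg_mul]
  exact mul_le_mul (Real.rpow_le_rpow_of_nonpos hs hst (by linarith))
    (mittagLeffler₂_neg_anti ha ha1 (by positivity) (by gcongr))
    (mittagLeffler₂_neg_pos ha ha1 (by positivity)).le (by positivity)

theorem mittagLeffler₂_neg_mul_rpow_le_two_pow_mul (ha : 1 / 2 ≤ a) (ha1 : a ≤ 1) (hμ : 0 < μ)
    (hs : 0 < s) (hst : s ≤ t) (hμst : μ * (t - s) ^ a ≤ 1) :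
    mittagLeffler₂ a a (-μ * s ^ a) ≤ 2 ^ 64 * mittagLeffler₂ a a (-μ * t ^ a) := by
  have ha0 : 0 < a := by linarith
  have hscale (u : ℝ) (hu : 0 ≤ u) : (μ ^ a⁻¹ * u) ^ a = μ * u ^ a := by
    rw [Real.mul_rpow (by positivity) hu, Real.rpow_inv_rpow hμ.le ha0.ne']
  have hgap : μ ^ a⁻¹ * t - μ ^ a⁻¹ * s ≤ 1 := by
    have hts : 0 ≤ t - s := sub_nonneg.2 hst
    rw [← mul_sub, ← Real.rpow_le_rpow_iff (by positivity) zero_le_one ha0, hscale _ hts,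
      Real.one_rpow]
    exact hμst
  have := mittagLeffler₂_neg_rpow_le_two_pow_mul (t := μ ^ a⁻¹ * s) (T := μ ^ a⁻¹ * t) ha ha1
    (by positivity) (by gcongr) hgap
  rwa [hscale s hs.le, hscale t (hs.le.trans hst), ← neg_mul, ← neg_mul] at this

end Kernel

end FracGronwall

/-! ### Averages of the Abel kernel -/

namespace FracGronwall

open MeasureTheory Set

theorem sub_mul_integral_mul_le_of_antitoneOn_of_monotoneOn {f g : ℝ → ℝ} {x y : ℝ} (hxy : x ≤ y)
    (hf : IntervalIntegrable f volume x y) (hg : IntervalIntegrable g volume x y)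
    (hfg : IntervalIntegrable (fun s => f s * g s) volume x y)
    (hfanti : AntitoneOn f (Ioo x y)) (hgmono : MonotoneOn g (Ioo x y)) :
    (y - x) * ∫ s in x..y, f s * g s ≤ (∫ s in x..y, f s) * ∫ s in x..y, g s := by
  set F := ∫ s in x..y, f s
  set G := ∫ s in x..y, g s
  set P := ∫ s in x..y, f s * g s
  -- Chebyshev: integrate `(f s - f r) * (g s - g r) ≤ 0` over the square.
  have hpair {s r : ℝ} (hs : s ∈ Ioo x y) (hr : r ∈ Ioo x y) :
      f s * g s + f r * g r ≤ f s * g r + f r * g s := by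
    obtain hsr | hrs := le_total s r
    · nlinarith [hfanti hs hr hsr, hgmono hs hr hsr]
    · nlinarith [hfanti hr hs hrs, hgmono hr hs hrs]
  have hinner (r : ℝ) (hr : r ∈ Ioo x y) : P + (y - x) * (f r * g r) ≤ F * g r + f r * G := by
    have hmono := intervalIntegral.integral_mono_on_of_le_Ioo hxy
      (hfg.add intervalIntegrable_const) ((hf.mul_const (g r)).add (hg.const_mul (f r)))
      fun s hs => hpair hs hr
    rwa [intervalIntegral.integral_add hfg intervalIntegrable_const,
      intervalIntegral.integral_add (hf.mul_const _) (hg.const_mul _),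
      intervalIntegral.integral_const, intervalIntegral.integral_mul_const,
      intervalIntegral.integral_const_mul, smul_eq_mul] at hmono
  have houter := intervalIntegral.integral_mono_on_of_le_Ioo hxy
    (intervalIntegrable_const.add (hfg.const_mul (y - x)))
    ((hg.const_mul F).add (hf.mul_const G)) hinner
  rw [intervalIntegral.integral_add intervalIntegrable_const (hfg.const_mul _),
    intervalIntegral.integral_add (hg.const_mul _) (hf.mul_const _),
    intervalIntegral.integral_const, intervalIntegral.integral_mul_const,
    intervalIntegral.integral_const_mul, intervalIntegral.integral_const_mul,
    smul_eq_mul] at houter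
  linarith

theorem integral_rpow_sub_one_le {b x y : ℝ} (hb : 0 < b) (hb1 : b ≤ 1) (hx : 0 ≤ x)
    (hxy : x ≤ y) (hy : 0 < y) : ∫ s in x..y, s ^ (b - 1) ≤ (y - x) * (y ^ (b - 1) / b) := by
  have hy_pow : y ^ (b - 1) * y = y ^ b := by
    rw [← Real.rpow_add_one hy.ne', sub_add_cancel]
  have hx_pow : y ^ (b - 1) * x ≤ x ^ b := by
    obtain rfl | hx := hx.eq_or_lt
    · simp [Real.zero_rpow hb.ne']
    · calc y ^ (b - 1) * x ≤ x ^ (b - 1) * x := by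
            gcongr ?_ * x
            exact Real.rpow_le_rpow_of_nonpos hx hxy (by linarith)
        _ = x ^ b := by rw [← Real.rpow_add_one hx.ne', sub_add_cancel]
  rw [integral_rpow (Or.inl (by linarith)), sub_add_cancel, mul_div_assoc',
    div_le_div_iff_of_pos_right hb]
  linarith

theorem integral_abelKernel_sub_le {b x y T : ℝ} (hb : 0 < b) (hb1 : b ≤ 1) (hxy : x < y)
    (hyT : y ≤ T) :
    ∫ s in x..y, abelKernel b (T - s) ≤ (y - x) * (abelKernel b (T - x) / b) := by
  have := Real.Gamma_pos_of_pos hb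
  have hpow : ∫ s in x..y, abelKernel b (T - s) =
      (∫ s in T - y..T - x, s ^ (b - 1)) / Real.Gamma b := by
    rw [intervalIntegral.integral_comp_sub_left, ← intervalIntegral.integral_div]
    refine intervalIntegral.integral_congr_uIoo fun s hs => ?_
    rw [uIoo_of_le (by linarith)] at hs
    exact abelKernel_of_pos b ((sub_nonneg.2 hyT).trans_lt hs.1)
  calc ∫ s in x..y, abelKernel b (T - s)
      ≤ (T - x - (T - y)) * ((T - x) ^ (b - 1) / b) / Real.Gamma b := by
        rw [hpow]
        gcongr
        exact integral_rpow_sub_one_le hb hb1 (by linarith) (by linarith) (by linarith)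
    _ = (y - x) * (abelKernel b (T - x) / b) := by
        rw [abelKernel_of_pos b (by linarith)]
        ring

theorem monotoneOn_abelKernel_sub {b : ℝ} (hb : 0 < b) (hb1 : b ≤ 1) (T : ℝ) :
    MonotoneOn (fun s => abelKernel b (T - s)) (Iio T) := fun _ hs _ hr hsr =>
  antitoneOn_abelKernel hb hb1 (mem_Ioi.2 (sub_pos.2 hr)) (mem_Ioi.2 (sub_pos.2 hs))
    (sub_le_sub_left hsr T)

section Average

variable {a b μ x y T : ℝ}

theorem intervalIntegrable_mittagLefflerKernel (ha : 0 < a) (hb : 0 < b) (z : ℝ) (x y : ℝ) :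
    IntervalIntegrable (mittagLefflerKernel a b z) volume x y :=
  (intervalIntegral.intervalIntegrable_rpow' (by linarith)).mul_continuousOn
    (continuous_mittagLeffler₂_comp_rpow ha hb z).continuousOn

theorem integral_mittagLefflerKernel_nonneg (ha : 0 < a) (ha1 : a ≤ 1) (hμ : 0 ≤ μ) (hx : 0 ≤ x)
    (hxy : x ≤ y) : 0 ≤ ∫ s in x..y, mittagLefflerKernel a a (-μ) s :=
  intervalIntegral.integral_nonneg hxy fun _ hs =>
    mittagLefflerKernel_neg_nonneg ha ha1 hμ (hx.trans hs.1)

theorem integral_mittagLefflerKernel_mul_le_average_mul (ha : 0 < a) (ha1 : a ≤ 1) (hb : 0 < b)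
    (hb1 : b ≤ 1) (hμ : 0 ≤ μ) (hx : 0 ≤ x) (hxy : x < y) (hyT : y ≤ T) :
    ∫ s in x..y, mittagLefflerKernel a a (-μ) s * abelKernel b (T - s) ≤
      (1 / (y - x) * ∫ s in x..y, abelKernel b (T - s)) *
        ∫ s in x..y, mittagLefflerKernel a a (-μ) s := by
  have hchebyshev := sub_mul_integral_mul_le_of_antitoneOn_of_monotoneOn hxy.le
    (intervalIntegrable_mittagLefflerKernel ha ha (-μ) x y)
    (intervalIntegrable_abelKernel_sub hb T x y)
    (intervalIntegrable_mittagLefflerKernel_mul_abelKernel_sub ha ha hb _ hx hxy.le hyT)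
    ((antitoneOn_mittagLefflerKernel_neg ha ha1 hμ).mono fun _ hs => hx.trans_lt hs.1)
    ((monotoneOn_abelKernel_sub hb hb1 T).mono fun _ hs => hs.2.trans_le hyT)
  rw [one_div_mul_eq_div, div_mul_eq_mul_div, le_div_iff₀ (sub_pos.2 hxy)]
  linarith

theorem average_mul_integral_mittagLefflerKernel_le (ha : 0 < a) (ha1 : a ≤ 1) (hb : 0 < b)
    (hb1 : b ≤ 1) (hμ : 0 ≤ μ) (hx : 0 ≤ x) (hxy : x < y) (hyT : y ≤ T) :
    (1 / (y - x) * ∫ s in x..y, abelKernel b (T - s)) *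
        ∫ s in x..y, mittagLefflerKernel a a (-μ) s ≤
      1 / b * ∫ s in x..y, mittagLefflerKernel a a (-μ) s * abelKernel b (T - s) := by
  have : 0 < y - x := sub_pos.2 hxy
  have hnonneg := integral_mittagLefflerKernel_nonneg ha ha1 hμ hx hxy.le
  have hleft : (∫ s in x..y, mittagLefflerKernel a a (-μ) s) * abelKernel b (T - x) ≤
      ∫ s in x..y, mittagLefflerKernel a a (-μ) s * abelKernel b (T - s) := by
    rw [← intervalIntegral.integral_mul_const]
    refine intervalIntegral.integral_mono_on_of_le_Ioo hxy.le
      ((intervalIntegrable_mittagLefflerKernel ha ha _ x y).mul_const _)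
      (intervalIntegrable_mittagLefflerKernel_mul_abelKernel_sub ha ha hb _ hx hxy.le hyT)
      fun s hs => mul_le_mul_of_nonneg_left ?_
        (mittagLefflerKernel_neg_nonneg ha ha1 hμ (hx.trans hs.1.le))
    exact monotoneOn_abelKernel_sub hb hb1 T (hxy.trans_le hyT) (hs.2.trans_le hyT) hs.1.le
  calc (1 / (y - x) * ∫ s in x..y, abelKernel b (T - s)) *
        ∫ s in x..y, mittagLefflerKernel a a (-μ) s
      ≤ (1 / (y - x) * ((y - x) * (abelKernel b (T - x) / b))) *
          ∫ s in x..y, mittagLefflerKernel a a (-μ) s := by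
        gcongr
        exact integral_abelKernel_sub_le hb hb1 hxy hyT
    _ = 1 / b * ((∫ s in x..y, mittagLefflerKernel a a (-μ) s) * abelKernel b (T - x)) := by
        field_simp
    _ ≤ 1 / b * ∫ s in x..y, mittagLefflerKernel a a (-μ) s * abelKernel b (T - s) := by gcongr

theorem integral_mittagLefflerKernel_le_two_pow_mul (ha : 1 / 2 ≤ a) (ha1 : a ≤ 1) (hμ : 0 < μ)
    (hx : 0 ≤ x) (hxy : x < y) (hμxy : μ * (y - x) ^ a ≤ 1) :
    ∫ s in x..y, mittagLefflerKernel a a (-μ) s ≤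
      2 ^ 65 * ((y - x) * mittagLefflerKernel a a (-μ) y) := by
  have ha0 : 0 < a := by linarith
  have hy : 0 < y := hx.trans_lt hxy
  have : 0 < y - x := sub_pos.2 hxy
  have hPy : 0 < mittagLeffler₂ a a (-μ * y ^ a) := by
    rw [neg_mul]
    exact mittagLeffler₂_neg_pos ha0 ha1 (by positivity)
  calc ∫ s in x..y, mittagLefflerKernel a a (-μ) s
      ≤ (∫ s in x..y, s ^ (a - 1)) * (2 ^ 64 * mittagLeffler₂ a a (-μ * y ^ a)) := by
        rw [← intervalIntegral.integral_mul_const]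
        refine intervalIntegral.integral_mono_on_of_le_Ioo hxy.le
          (intervalIntegrable_mittagLefflerKernel ha0 ha0 _ x y)
          ((intervalIntegral.intervalIntegrable_rpow' (by linarith)).mul_const _) fun s hs => ?_
        have hs0 : 0 < s := hx.trans_lt hs.1
        have hμsy : μ * (y - s) ^ a ≤ 1 := by
          have hys : 0 ≤ y - s := sub_nonneg.2 hs.2.le
          refine le_trans ?_ hμxy
          gcongr
          exact hs.1.le
        exact mul_le_mul_of_nonneg_left
          (mittagLeffler₂_neg_mul_rpow_le_two_pow_mul ha ha1 hμ hs0 hs.2.le hμsy) (by positivity)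
    _ ≤ (y - x) * (y ^ (a - 1) / (1 / 2)) * (2 ^ 64 * mittagLeffler₂ a a (-μ * y ^ a)) := by
        gcongr
        refine (integral_rpow_sub_one_le ha0 ha1 hx hxy.le hy).trans ?_
        gcongr
    _ = 2 ^ 65 * ((y - x) * mittagLefflerKernel a a (-μ) y) := by
        rw [mittagLefflerKernel]
        ring

theorem average_mul_integral_mittagLefflerKernel_le_two_pow_mul (ha : 0 < a) (ha1 : a < 1)
    (hμ : 0 < μ) (hx : 0 ≤ x) (hxy : x < y) (hyT : y ≤ T) (hμxy : μ * (y - x) ^ a ≤ 1) :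
    (1 / (y - x) * ∫ s in x..y, abelKernel (1 - a) (T - s)) *
        ∫ s in x..y, mittagLefflerKernel a a (-μ) s ≤
      2 ^ 65 * ∫ s in x..y, mittagLefflerKernel a a (-μ) s * abelKernel (1 - a) (T - s) := by
  have hb : 0 < 1 - a := sub_pos.2 ha1
  have : 0 < y - x := sub_pos.2 hxy
  have hgnonneg (s : ℝ) : 0 ≤ abelKernel (1 - a) (T - s) := abelKernel_nonneg hb _
  obtain ha2 | ha2 := le_or_gt (1 / 2) a
  · have hright : mittagLefflerKernel a a (-μ) y * ∫ s in x..y, abelKernel (1 - a) (T - s) ≤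
        ∫ s in x..y, mittagLefflerKernel a a (-μ) s * abelKernel (1 - a) (T - s) := by
      rw [← intervalIntegral.integral_const_mul]
      refine intervalIntegral.integral_mono_on_of_le_Ioo hxy.le
        ((intervalIntegrable_abelKernel_sub hb T x y).const_mul _)
        (intervalIntegrable_mittagLefflerKernel_mul_abelKernel_sub ha ha hb _ hx hxy.le hyT)
        fun s hs => mul_le_mul_of_nonneg_right ?_ (hgnonneg s)
      exact antitoneOn_mittagLefflerKernel_neg ha ha1.le hμ.le (hx.trans_lt hs.1)
        (hx.trans_lt hxy) hs.2.le
    have hg : 0 ≤ ∫ s in x..y, abelKernel (1 - a) (T - s) :=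
      intervalIntegral.integral_nonneg hxy.le fun s _ => hgnonneg s
    calc (1 / (y - x) * ∫ s in x..y, abelKernel (1 - a) (T - s)) *
          ∫ s in x..y, mittagLefflerKernel a a (-μ) s
        ≤ (1 / (y - x) * ∫ s in x..y, abelKernel (1 - a) (T - s)) *
            (2 ^ 65 * ((y - x) * mittagLefflerKernel a a (-μ) y)) := by
          gcongr
          exact integral_mittagLefflerKernel_le_two_pow_mul ha2 ha1.le hμ hx hxy hμxy
      _ = 2 ^ 65 * (mittagLefflerKernel a a (-μ) y *
            ∫ s in x..y, abelKernel (1 - a) (T - s)) := by field_simp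
      _ ≤ _ := by gcongr
  · refine (average_mul_integral_mittagLefflerKernel_le ha ha1.le hb (by linarith) hμ.le hx hxy
      hyT).trans (mul_le_mul_of_nonneg_right ?_ ?_)
    · rw [div_le_iff₀ hb]
      linarith
    · exact intervalIntegral.integral_nonneg hxy.le fun s hs =>
        mul_nonneg (mittagLefflerKernel_neg_nonneg ha ha1.le hμ.le (hx.trans hs.1)) (hgnonneg s)

end Average

end FracGronwall

/-! ### The Mittag-Leffler function on a grid -/

namespace FracGronwall

open MeasureTheory

section Grid

variable {N : ℕ∞} {t : ℕ → ℝ} {n : ℕ}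

theorem IsGrid.mono (ht : IsGrid N t) {i j : ℕ} (hij : i ≤ j) (hj : (j : ℕ∞) ≤ N) : t i ≤ t j := by
  induction j, hij using Nat.le_induction with
  | base => rfl
  | succ j _ ih =>
    exact (ih (hj.trans' (by gcongr; omega))).trans (ht.lt (j + 1) (by omega) hj).le

theorem IsGrid.nonneg_and_lt_and_le (ht : IsGrid N t) (hn : (n : ℕ∞) ≤ N) {j : ℕ} (hj : 1 ≤ j)
    (hjn : j ≤ n) :
    0 ≤ t (j - 1) ∧ t (j - 1) < t j ∧ t j ≤ t n := by
  have hjN : (j : ℕ∞) ≤ N := hn.trans' (by gcongr)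
  refine ⟨?_, ht.lt j hj hjN, ht.mono hjn hn⟩
  rw [← ht.zero]
  exact ht.mono (Nat.zero_le _) (hjN.trans' (by gcongr; omega))

theorem sum_Icc_integral_adjacent {f : ℝ → ℝ}
    (hf : ∀ j, 1 ≤ j → j ≤ n → IntervalIntegrable f volume (t (j - 1)) (t j)) :
    ∑ j ∈ Finset.Icc 1 n, ∫ s in t (j - 1)..t j, f s = ∫ s in t 0..t n, f s := by
  have hsum := intervalIntegral.sum_integral_adjacent_intervals (a := t) (f := f) (μ := volume)
    (n := n) fun k hk => hf (k + 1) (by omega) hk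
  rw [← hsum, Finset.range_eq_Ico]
  exact (Finset.sum_Ico_add' (fun j => ∫ s in t (j - 1)..t j, f s) 0 n 1).symm

end Grid

section Scheme

variable {a μ T x y : ℝ}

theorem integral_mittagLefflerKernel_mul_abelKernel_one_sub (ha : 0 < a) (ha1 : a < 1) (z : ℝ)
    (hT : 0 < T) :
    ∫ s in (0 : ℝ)..T, mittagLefflerKernel a a z s * abelKernel (1 - a) (T - s) =
      mittagLeffler a (z * T ^ a) := by
  rw [integral_mittagLefflerKernel_mul_abelKernel_sub ha ha (sub_pos.2 ha1) z hT,
    add_sub_cancel, mittagLefflerKernel, sub_self, Real.rpow_zero, one_mul, mittagLeffler]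

theorem mittagLeffler_zero (ha : 0 < a) : mittagLeffler a 0 = 1 := by
  rw [mittagLeffler, mittagLeffler₂_zero ha, Real.Gamma_one, div_one]

theorem mul_integral_mittagLefflerKernel (ha : 0 < a) (z : ℝ) (hT : 0 ≤ T) :
    z * ∫ s in (0 : ℝ)..T, mittagLefflerKernel a a z s = mittagLeffler a (z * T ^ a) - 1 := by
  obtain rfl | hT := hT.eq_or_lt
  · simp [Real.zero_rpow ha.ne', mittagLeffler_zero ha]
  have hone : ∫ s in (0 : ℝ)..T, mittagLefflerKernel a a z s =
      ∫ s in (0 : ℝ)..T, mittagLefflerKernel a a z s * abelKernel 1 (T - s) := by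
    refine intervalIntegral.integral_congr_uIoo fun s hs => ?_
    rw [Set.uIoo_of_le hT.le] at hs
    simp [abelKernel_of_pos 1 (sub_pos.2 hs.2)]
  rw [hone, integral_mittagLefflerKernel_mul_abelKernel_sub ha ha one_pos z hT,
    mittagLefflerKernel, add_sub_cancel_right, mittagLeffler, mittagLeffler₂_eq_add ha 1,
    Real.Gamma_one]
  ring

theorem mittagLeffler_mul_rpow_sub (ha : 0 < a) (z : ℝ) (hx : 0 ≤ x) (hy : 0 ≤ y) :
    mittagLeffler a (z * y ^ a) - mittagLeffler a (z * x ^ a) =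
      z * ∫ s in x..y, mittagLefflerKernel a a z s := by
  have hint := intervalIntegrable_mittagLefflerKernel ha ha z
  rw [← intervalIntegral.integral_interval_sub_left (hint 0 y) (hint 0 x), mul_sub,
    mul_integral_mittagLefflerKernel ha z hx, mul_integral_mittagLefflerKernel ha z hy]
  ring

variable {N : ℕ∞} {t : ℕ → ℝ} {C : ArrayKernel} {n : ℕ} {ν ρ K : ℝ}

theorem discreteDeriv_mittagLeffler (ha : 0 < a) (ht : IsGrid N t) (C : ArrayKernel) (z : ℝ)
    (hn : (n : ℕ∞) ≤ N) :
    discreteDeriv C (fun k => mittagLeffler a (z * t k ^ a)) n =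
      z * ∑ j ∈ Finset.Icc 1 n,
        C n (n - j) * ∫ s in t (j - 1)..t j, mittagLefflerKernel a a z s := by
  rw [discreteDeriv, Finset.mul_sum]
  refine Finset.sum_congr rfl fun j hj => ?_
  obtain ⟨hj1, hjn⟩ := Finset.mem_Icc.1 hj
  obtain ⟨h0, hlt, -⟩ := ht.nonneg_and_lt_and_le hn hj1 hjn
  rw [mittagLeffler_mul_rpow_sub ha z h0 (h0.trans hlt.le), mul_left_comm]

theorem sum_integral_mittagLefflerKernel_mul_abelKernel_sub (ha : 0 < a) (ha1 : a < 1)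
    (ht : IsGrid N t) (z : ℝ) (hn1 : 1 ≤ n) (hn : (n : ℕ∞) ≤ N) :
    ∑ j ∈ Finset.Icc 1 n, ∫ s in t (j - 1)..t j,
        mittagLefflerKernel a a z s * abelKernel (1 - a) (t n - s) =
      mittagLeffler a (z * t n ^ a) := by
  obtain ⟨h0, hlt, -⟩ := ht.nonneg_and_lt_and_le hn hn1 le_rfl
  rw [sum_Icc_integral_adjacent fun j hj hjn => ?_, ht.zero,
    integral_mittagLefflerKernel_mul_abelKernel_one_sub ha ha1 z (h0.trans_lt hlt)]
  obtain ⟨h0, hlt, hle⟩ := ht.nonneg_and_lt_and_le hn hj hjn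
  exact intervalIntegrable_mittagLefflerKernel_mul_abelKernel_sub ha ha (sub_pos.2 ha1) z h0
    hlt.le hle

theorem KernelLowerBound.discreteDeriv_mittagLeffler_le (hC : KernelLowerBound a N t C ν)
    (ha : 0 < a) (ha1 : a < 1) (ht : IsGrid N t) (hν : 0 ≤ ν) (hμ : 0 ≤ μ) (hn1 : 1 ≤ n)
    (hn : (n : ℕ∞) ≤ N) :
    discreteDeriv C (fun k => mittagLeffler a (-μ * t k ^ a)) n ≤
      -(μ * ν) * mittagLeffler a (-μ * t n ^ a) := by
  rw [discreteDeriv_mittagLeffler ha ht C _ hn,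
    ← sum_integral_mittagLefflerKernel_mul_abelKernel_sub ha ha1 ht _ hn1 hn, ← neg_mul, mul_assoc,
    Finset.mul_sum _ _ ν]
  refine mul_le_mul_of_nonpos_left (Finset.sum_le_sum fun j hj => ?_) (neg_nonpos.2 hμ)
  obtain ⟨hj1, hjn⟩ := Finset.mem_Icc.1 hj
  obtain ⟨h0, hlt, hle⟩ := ht.nonneg_and_lt_and_le hn hj1 hjn
  calc ν * ∫ s in t (j - 1)..t j, mittagLefflerKernel a a (-μ) s * abelKernel (1 - a) (t n - s)
      ≤ ν * (kernelAverage a t n j * ∫ s in t (j - 1)..t j, mittagLefflerKernel a a (-μ) s) :=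
        mul_le_mul_of_nonneg_left (integral_mittagLefflerKernel_mul_le_average_mul ha ha1.le
          (sub_pos.2 ha1) (by linarith) hμ h0 hlt hle) hν
    _ ≤ C n (n - j) * ∫ s in t (j - 1)..t j, mittagLefflerKernel a a (-μ) s := by
        rw [← mul_assoc]
        exact mul_le_mul_of_nonneg_right (hC n j hj1 hjn hn)
          (integral_mittagLefflerKernel_nonneg ha ha1.le hμ h0 hlt.le)

theorem KernelUpperBound.le_discreteDeriv_mittagLeffler (hC : KernelUpperBound a N t C ρ)
    (ha : 0 < a) (ha1 : a < 1) (ht : IsGrid N t) (hρ : 0 ≤ ρ) (hμ : 0 ≤ μ)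
    (hK : ∀ j, 1 ≤ j → j ≤ n →
      kernelAverage a t n j * ∫ s in t (j - 1)..t j, mittagLefflerKernel a a (-μ) s ≤
        K * ∫ s in t (j - 1)..t j, mittagLefflerKernel a a (-μ) s * abelKernel (1 - a) (t n - s))
    (hn1 : 1 ≤ n) (hn : (n : ℕ∞) ≤ N) :
    -(μ * (K * ρ)) * mittagLeffler a (-μ * t n ^ a) ≤
      discreteDeriv C (fun k => mittagLeffler a (-μ * t k ^ a)) n := by
  rw [discreteDeriv_mittagLeffler ha ht C _ hn,
    ← sum_integral_mittagLefflerKernel_mul_abelKernel_sub ha ha1 ht _ hn1 hn, ← neg_mul, mul_assoc,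
    Finset.mul_sum _ _ (K * ρ)]
  refine mul_le_mul_of_nonpos_left (Finset.sum_le_sum fun j hj => ?_) (neg_nonpos.2 hμ)
  obtain ⟨hj1, hjn⟩ := Finset.mem_Icc.1 hj
  obtain ⟨h0, hlt, -⟩ := ht.nonneg_and_lt_and_le hn hj1 hjn
  calc C n (n - j) * ∫ s in t (j - 1)..t j, mittagLefflerKernel a a (-μ) s
      ≤ ρ * kernelAverage a t n j * ∫ s in t (j - 1)..t j, mittagLefflerKernel a a (-μ) s :=
        mul_le_mul_of_nonneg_right (hC n j hj1 hjn hn)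
          (integral_mittagLefflerKernel_nonneg ha ha1.le hμ h0 hlt.le)
    _ ≤ K * ρ *
          ∫ s in t (j - 1)..t j, mittagLefflerKernel a a (-μ) s * abelKernel (1 - a) (t n - s) := by
        rw [mul_comm K, mul_assoc, mul_assoc]
        exact mul_le_mul_of_nonneg_left (hK j hj1 hjn) hρ

variable {lam c : ℝ} {v : ℕ → ℝ}

theorem IsMonotoneKernel.mul_mittagLeffler_add_le (hM : IsMonotoneKernel N C)
    (hC : KernelLowerBound a N t C ν) (ha : 0 < a) (ha1 : a < 1) (ht : IsGrid N t) (hν : 0 < ν)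
    (hlam : 0 < lam) (h0 : c / lam ≤ v 0)
    (hv : ∀ n : ℕ, 1 ≤ n → (n : ℕ∞) ≤ N → -lam * v n + c ≤ discreteDeriv C v n)
    (hn : (n : ℕ∞) ≤ N) :
    (v 0 - c / lam) * mittagLeffler a (-(ν⁻¹ * lam * t n ^ a)) + c / lam ≤ v n := by
  rw [← neg_mul]
  refine hM.mul_add_le_of_subsolution (φ := fun k => mittagLeffler a (-(ν⁻¹ * lam) * t k ^ a))
    hlam h0 ?_ (fun m hm hmN => ?_) hv n hn
  · rw [ht.zero, Real.zero_rpow ha.ne', mul_zero, mittagLeffler_zero ha]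
  · have hφ := hC.discreteDeriv_mittagLeffler_le ha ha1 ht hν.le (μ := ν⁻¹ * lam) (by positivity)
      hm hmN
    rwa [show ν⁻¹ * lam * ν = lam by field_simp] at hφ

theorem IsMonotoneKernel.le_mul_mittagLeffler_add (hM : IsMonotoneKernel N C)
    (hC : KernelUpperBound a N t C ρ) (ha : 0 < a) (ha1 : a < 1) (ht : IsGrid N t) (hρ : 0 < ρ)
    (hlam : 0 < lam) (h0 : c / lam ≤ v 0) (hK0 : 0 < K)
    (hK : ∀ n j : ℕ, (n : ℕ∞) ≤ N → 1 ≤ j → j ≤ n →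
      kernelAverage a t n j * ∫ s in t (j - 1)..t j, mittagLefflerKernel a a (-(lam / (K * ρ))) s ≤
        K * ∫ s in t (j - 1)..t j,
          mittagLefflerKernel a a (-(lam / (K * ρ))) s * abelKernel (1 - a) (t n - s))
    (hv : ∀ n : ℕ, 1 ≤ n → (n : ℕ∞) ≤ N → discreteDeriv C v n ≤ -lam * v n + c)
    (hn : (n : ℕ∞) ≤ N) :
    v n ≤ (v 0 - c / lam) * mittagLeffler a (-(lam / (K * ρ) * t n ^ a)) + c / lam := by
  rw [← neg_mul]
  refine hM.le_mul_add_of_supersolution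
    (φ := fun k => mittagLeffler a (-(lam / (K * ρ)) * t k ^ a)) hlam h0 ?_
    (fun m hm hmN => ?_) hv n hn
  · rw [ht.zero, Real.zero_rpow ha.ne', mul_zero, mittagLeffler_zero ha]
  · have hφ := hC.le_discreteDeriv_mittagLeffler ha ha1 ht hρ.le (by positivity)
      (fun j => hK m j hmN) hm hmN
    rwa [div_mul_cancel₀ _ (by positivity)] at hφ

theorem IsMonotoneKernel.le_mul_mittagLeffler_one_sub_add (hM : IsMonotoneKernel N C)
    (hC : KernelUpperBound a N t C ρ) (ha : 0 < a) (ha1 : a < 1) (ht : IsGrid N t) (hρ : 0 < ρ)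
    (hlam : 0 < lam) (h0 : c / lam ≤ v 0)
    (hv : ∀ n : ℕ, 1 ≤ n → (n : ℕ∞) ≤ N → discreteDeriv C v n ≤ -lam * v n + c)
    (hn : (n : ℕ∞) ≤ N) :
    v n ≤ (v 0 - c / lam) * mittagLeffler a (-(lam * (1 - a) / ρ * t n ^ a)) + c / lam := by
  have hb : 0 < 1 - a := sub_pos.2 ha1
  rw [show lam * (1 - a) / ρ = lam / (1 / (1 - a) * ρ) by field_simp]
  refine hM.le_mul_mittagLeffler_add hC ha ha1 ht hρ hlam h0 (one_div_pos.2 hb)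
    (fun m j hmN hj hjm => ?_) hv hn
  obtain ⟨h0, hlt, hle⟩ := ht.nonneg_and_lt_and_le hmN hj hjm
  exact average_mul_integral_mittagLefflerKernel_le ha ha1.le hb (by linarith) (by positivity) h0
    hlt hle

theorem IsMonotoneKernel.le_mul_mittagLeffler_two_pow_add (hM : IsMonotoneKernel N C)
    (hC : KernelUpperBound a N t C ρ) (ha : 0 < a) (ha1 : a < 1) (ht : IsGrid N t) (hρ : 0 < ρ)
    (hlam : 0 < lam) (h0 : c / lam ≤ v 0)
    (hstep : ∀ n : ℕ, 1 ≤ n → (n : ℕ∞) ≤ N → lam * step t n ^ a ≤ 2 ^ 65 * ρ)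
    (hv : ∀ n : ℕ, 1 ≤ n → (n : ℕ∞) ≤ N → discreteDeriv C v n ≤ -lam * v n + c)
    (hn : (n : ℕ∞) ≤ N) :
    v n ≤ (v 0 - c / lam) * mittagLeffler a (-(lam / (2 ^ 65 * ρ) * t n ^ a)) + c / lam := by
  refine hM.le_mul_mittagLeffler_add hC ha ha1 ht hρ hlam h0 (by positivity)
    (fun m j hmN hj hjm => ?_) hv hn
  obtain ⟨h0, hlt, hle⟩ := ht.nonneg_and_lt_and_le hmN hj hjm
  refine average_mul_integral_mittagLefflerKernel_le_two_pow_mul ha ha1 (by positivity) h0 hlt hle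
    ?_
  rw [div_mul_eq_mul_div]
  exact div_le_one_of_le₀ (hstep j hj (hmN.trans' (by gcongr))) (by positivity)

end Scheme

end FracGronwall

theorem theorem4p2_general :
    ∃ σ : ℝ, 1 < σ ∧
      ∀ (α : ℝ), 0 < α → α < 1 →
      ∀ (N : ℕ∞) (t : ℕ → ℝ), FracGronwall.IsGrid N t →
      ∀ (C : FracGronwall.ArrayKernel), FracGronwall.IsMonotoneKernel N C →
      ∀ (lam c : ℝ), 0 < lam →
      ∀ (v : ℕ → ℝ), c / lam ≤ v 0 →
        (∀ ν : ℝ, 0 < ν → FracGronwall.KernelLowerBound α N t C ν →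
          (∀ n : ℕ, 1 ≤ n → (n : ℕ∞) ≤ N →
            -lam * v n + c ≤ FracGronwall.discreteDeriv C v n) →
          ∀ n : ℕ, (n : ℕ∞) ≤ N →
            (v 0 - c / lam) * FracGronwall.mittagLeffler α (-(ν⁻¹ * lam * t n ^ α)) + c / lam
              ≤ v n) ∧
        (∀ ρ₁ : ℝ, 0 < ρ₁ → FracGronwall.KernelUpperBound α N t C ρ₁ →
          (∀ n : ℕ, 1 ≤ n → (n : ℕ∞) ≤ N →
            FracGronwall.discreteDeriv C v n ≤ -lam * v n + c) →
          (∀ n : ℕ, (n : ℕ∞) ≤ N →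
            v n ≤ (v 0 - c / lam) *
                FracGronwall.mittagLeffler α (-(lam * (1 - α) / ρ₁ * t n ^ α)) + c / lam) ∧
          ((∀ n : ℕ, 1 ≤ n → (n : ℕ∞) ≤ N → lam * FracGronwall.step t n ^ α ≤ σ * ρ₁) →
            ∀ n : ℕ, (n : ℕ∞) ≤ N →
              v n ≤ (v 0 - c / lam) *
                  FracGronwall.mittagLeffler α (-(lam / (σ * ρ₁) * t n ^ α)) + c / lam)) := by
  refine ⟨2 ^ 65, by norm_num, fun α hα hα1 N t ht C hM lam c hlam v h0 => ⟨?_, ?_⟩⟩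
  · exact fun ν hν hC hv n hn => hM.mul_mittagLeffler_add_le hC hα hα1 ht hν hlam h0 hv hn
  · exact fun ρ hρ hC hv =>
      ⟨fun n hn => hM.le_mul_mittagLeffler_one_sub_add hC hα hα1 ht hρ hlam h0 hv hn,
        fun hstep n hn =>
          hM.le_mul_mittagLeffler_two_pow_add hC hα hα1 ht hρ hlam h0 hstep hv hn⟩

theorem theorem4p2 :
    ∃ σ : ℝ, 1 < σ ∧
      ∀ (α : ℝ), 0 < α → α < 1 →
      ∀ (N : ℕ∞) (t : ℕ → ℝ), FracGronwall.IsGrid N t →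
      ∀ (C : FracGronwall.ArrayKernel), FracGronwall.CompletelyPositiveScheme N C →
      ∀ (lam c : ℝ), 0 < lam →
      ∀ (v : ℕ → ℝ), (∀ n : ℕ, (n : ℕ∞) ≤ N → 0 ≤ v n) → c / lam < v 0 →
        (∀ ν : ℝ, 0 < ν → FracGronwall.KernelLowerBound α N t C ν →
          (∀ n : ℕ, 1 ≤ n → (n : ℕ∞) ≤ N →
            -lam * v n + c ≤ FracGronwall.discreteDeriv C v n) →
          ∀ n : ℕ, (n : ℕ∞) ≤ N →
            (v 0 - c / lam) * FracGronwall.mittagLeffler α (-(ν⁻¹ * lam * t n ^ α)) + c / lam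
              ≤ v n) ∧
        (∀ ρ₁ : ℝ, 0 < ρ₁ → FracGronwall.KernelUpperBound α N t C ρ₁ →
          (∀ n : ℕ, 1 ≤ n → (n : ℕ∞) ≤ N →
            FracGronwall.discreteDeriv C v n ≤ -lam * v n + c) →
          (∀ n : ℕ, (n : ℕ∞) ≤ N →
            v n ≤ (v 0 - c / lam) *
                FracGronwall.mittagLeffler α (-(lam * (1 - α) / ρ₁ * t n ^ α)) + c / lam) ∧
          ((∀ n : ℕ, 1 ≤ n → (n : ℕ∞) ≤ N → lam * FracGronwall.step t n ^ α ≤ 1) →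
            1 ≤ σ * ρ₁ →
            ∀ n : ℕ, (n : ℕ∞) ≤ N →
              v n ≤ (v 0 - c / lam) *
                  FracGronwall.mittagLeffler α (-(lam / (σ * ρ₁) * t n ^ α)) + c / lam)) := by
  obtain ⟨σ, hσ, hmain⟩ := theorem4p2_general
  refine ⟨σ, hσ, fun α hα hα1 N t ht C hC lam c hlam v _ h0 => ?_⟩
  obtain ⟨hlower, hupper⟩ := hmain α hα hα1 N t ht C hC.isMonotoneKernel lam c hlam v h0.le
  exact ⟨hlower, fun ρ hρ hCρ hv => (hupper ρ hρ hCρ hv).imp_right fun hsmall hstep hσρ =>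
    hsmall fun n hn hnN => (hstep n hn hnN).trans hσρ⟩
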